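/- Let $E_1 : y^2+xy+y=x^3+x^2-10x-10$ and $E_2 : y^2+xy+y=x^3+x^2-5x+2$ be elliptic curves over $\mathbb{Q}$, and let $i\in\{1,2\}$. Let $K$ be a real quadratic field and $p$ an odd prime such that (1) $K\neq\mathbb{Q}(\sqrt5)$; (2) the Mordell--Weil group $E_i(K)$ is finite; (3) the $p$-primary part of the Tate--Shafarevich group of $E_i$ over $K$ is trivial; (4) $p$ splits completely in $K$. Let $K_\infty$ be the cyclotomic $\mathbb{Z}_p$-extension of $K$, i.e. the Galois subextension of $K(\mu_{p^\infty})/K$ with $\operatorname{Gal}(K_\infty/K)\cong\mathbb{Z}_p$ as topological groups. For an abelian group $A$ write $A[l^\infty]=\{a\in A : l^n a=0 \text{ for some } n\ge 0\}$. Then for every odd prime $l$, $$E_i(\mathbb{Q})[l^\infty]=E_i(K_\infty)[l^\infty],$$ that is, the inclusion $E_i(\mathbb{Q})\to E_i(K_\infty)$ maps $E_i(\mathbb{Q})[l^\infty]$ onto $E_i(K_\infty)[l^\infty]$. -/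

import Mathlib

open scoped WeierstrassCurve.Affine

noncomputable section

namespace EllCurve

universe u v

/-- The elliptic curves `E₁ : y² + xy + y = x³ + x² - 10x - 10` (index `0`) and
`E₂ : y² + xy + y = x³ + x² - 5x + 2` (index `1`) over `ℚ`. -/
def E : Fin 2 → WeierstrassCurve.Affine ℚ :=
  ![⟨1, 1, 1, -10, -10⟩, ⟨1, 1, 1, -5, 2⟩]

section Restriction

variable (k : Type u) [Field k] (F : Type v) [Field F] [Algebra k F]

/-- A chosen `k`-embedding of the algebraic closure of `k` into that of an extension field `F`. -/
def closureEmb : AlgebraicClosure k →ₐ[k] AlgebraicClosure F :=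
  IsAlgClosed.lift

/-- The restriction homomorphism `G_F → G_k` between absolute Galois groups attached to the
chosen embedding of algebraic closures. -/
def galRes : Gal(AlgebraicClosure F/F) →* Gal(AlgebraicClosure k/k) :=
  letI : Algebra (AlgebraicClosure k) (AlgebraicClosure F) := (closureEmb k F).toRingHom.toAlgebra
  haveI : IsScalarTower k (AlgebraicClosure k) (AlgebraicClosure F) :=
    IsScalarTower.of_algebraMap_eq fun x => ((closureEmb k F).commutes x).symm
  (AlgEquiv.restrictNormalHom (AlgebraicClosure k)).comp
    (AlgEquiv.restrictScalarsHom k : Gal(AlgebraicClosure F/F) →* Gal(AlgebraicClosure F/k))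

theorem closureEmb_galRes (σ : Gal(AlgebraicClosure F/F)) (x : AlgebraicClosure k) :
    closureEmb k F (galRes k F σ x) = σ (closureEmb k F x) := by
  let _ : Algebra (AlgebraicClosure k) (AlgebraicClosure F) := (closureEmb k F).toRingHom.toAlgebra
  have : IsScalarTower k (AlgebraicClosure k) (AlgebraicClosure F) :=
    IsScalarTower.of_algebraMap_eq fun x => ((closureEmb k F).commutes x).symm
  exact AlgEquiv.restrictNormal_commutes (AlgEquiv.restrictScalars k σ) (AlgebraicClosure k) x

theorem continuous_galRes : Continuous (galRes k F) := by
  refine continuous_of_continuousAt_one _ ?_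
  rw [ContinuousAt, map_one]
  intro A hA
  rw [krullTopology_mem_nhds_one_iff] at hA
  obtain ⟨L, hL, hLA⟩ := hA
  obtain ⟨S, hS, rfl⟩ := IntermediateField.fg_def.mp 
    (IntermediateField.essFiniteType_iff.mp inferInstance : L.FG)
  have : Finite (closureEmb k F '' S) := (hS.image _).to_subtype
  rw [Filter.mem_map, krullTopology_mem_nhds_one_iff]
  refine ⟨IntermediateField.adjoin F (closureEmb k F '' S),
    IntermediateField.finiteDimensional_adjoin fun x _ => Algebra.IsIntegral.isIntegral x,
    fun σ hσ => hLA ?_⟩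
  have key : IntermediateField.adjoin k S ≤
      IntermediateField.fixedField (Subgroup.zpowers (galRes k F σ)) := by
    rw [IntermediateField.adjoin_le_iff]
    intro x hx
    have hfix : galRes k F σ x = x := by
      apply (closureEmb k F).injective
      refine (closureEmb_galRes k F σ x).trans ?_
      exact (IntermediateField.mem_fixingSubgroup_iff _ σ).mp hσ _
        (IntermediateField.subset_adjoin _ _ ⟨x, hx, rfl⟩)
    rintro ⟨τ, hτ⟩
    have hle : Subgroup.zpowers (galRes k F σ) ≤ MulAction.stabilizer _ x := by
      rw [Subgroup.zpowers_le]
      exact hfix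
    exact hle hτ
  exact (IntermediateField.le_iff_le _ _).mp key (Subgroup.mem_zpowers _)

end Restriction

section Cohomology

open scoped Classical

variable {k : Type u} [Field k] (W : WeierstrassCurve.Affine k)
variable (F : Type v) [Field F] [Algebra k F]

/-- The points of `W` over the algebraic closure of an extension field `F` of the base field. -/
abbrev GeomPoint : Type v := (W⁄(AlgebraicClosure F)).Point

/-- The action of an element of the absolute Galois group `G_F` on `W(F̄)`. -/
def galAct (σ : Gal(AlgebraicClosure F/F)) : GeomPoint W F →+ GeomPoint W F :=
  WeierstrassCurve.Affine.Point.map (σ : AlgebraicClosure F →ₐ[F] AlgebraicClosure F)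

/-- Continuous (that is, locally constant) `1`-cocycles `G_F → W(F̄)`. -/
def Z1 : AddSubgroup (Gal(AlgebraicClosure F/F) → GeomPoint W F) where
  carrier := {f | IsLocallyConstant f ∧ ∀ σ τ, f (σ * τ) = f σ + galAct W F σ (f τ)}
  zero_mem' := ⟨IsLocallyConstant.const 0, fun σ τ => by simp⟩
  add_mem' := by
    rintro f g ⟨hf, hf'⟩ ⟨hg, hg'⟩
    refine ⟨hf.add hg, fun σ τ => ?_⟩
    simp only [Pi.add_apply, hf', hg', map_add]
    abel
  neg_mem' := by
    rintro f ⟨hf, hf'⟩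
    refine ⟨hf.neg, fun σ τ => ?_⟩
    simp only [Pi.neg_apply, hf', map_neg]
    abel

/-- `1`-coboundaries `σ ↦ σ P - P` with `P ∈ W(F̄)`. -/
def B1 : AddSubgroup (Gal(AlgebraicClosure F/F) → GeomPoint W F) where
  carrier := {f | ∃ P : GeomPoint W F, ∀ σ, f σ = galAct W F σ P - P}
  zero_mem' := ⟨0, fun σ => by simp⟩
  add_mem' := by
    rintro f g ⟨P, hP⟩ ⟨Q, hQ⟩
    refine ⟨P + Q, fun σ => ?_⟩
    simp only [Pi.add_apply, hP, hQ, map_add]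
    abel
  neg_mem' := by
    rintro f ⟨P, hP⟩
    refine ⟨-P, fun σ => ?_⟩
    simp only [Pi.neg_apply, hP, map_neg]
    abel

/-- The Galois cohomology group `H¹(F, W) = H¹(G_F, W(F̄))`. -/
def H1 : Type v := Z1 W F ⧸ (B1 W F).addSubgroupOf (Z1 W F)

instance : AddCommGroup (H1 W F) :=
  inferInstanceAs (AddCommGroup (Z1 W F ⧸ (B1 W F).addSubgroupOf (Z1 W F)))

/-- The map `W(k̄) → W(F̄)` induced by the chosen embedding of algebraic closures. -/
def pointEmb : GeomPoint W k →+ GeomPoint W F :=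
  WeierstrassCurve.Affine.Point.map (closureEmb k F)

theorem pointEmb_galAct (σ : Gal(AlgebraicClosure F/F)) (P : GeomPoint W k) :
    pointEmb W F (galAct W k (galRes k F σ) P) = galAct W F σ (pointEmb W F P) := by
  rcases P with _ | ⟨x, y, h⟩
  · rfl
  · simp only [pointEmb, galAct, WeierstrassCurve.Affine.Point.map_some]
    congr 1 <;> exact closureEmb_galRes k F σ _

/-- Restriction of cocycles from `G_k` to `G_F`. -/
def resZ1 : Z1 W k →+ Z1 W F where
  toFun f := ⟨fun σ => pointEmb W F (f.1 (galRes k F σ)),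
    (f.2.1.comp_continuous (continuous_galRes k F)).comp (pointEmb W F), fun σ τ => by
      change pointEmb W F (f.1 (galRes k F (σ * τ))) = pointEmb W F (f.1 (galRes k F σ)) +
        galAct W F σ (pointEmb W F (f.1 (galRes k F τ)))
      rw [map_mul, f.2.2, map_add, pointEmb_galAct]⟩
  map_zero' := by ext1; funext σ; exact map_zero _
  map_add' f g := by ext1; funext σ; exact map_add _ _ _

/-- The restriction map `H¹(k, W) → H¹(F, W)`. -/
def resH1 : H1 W k →+ H1 W F :=
  QuotientAddGroup.map _ _ (resZ1 W F) (by
    rintro f ⟨P, hP⟩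
    refine ⟨pointEmb W F P, fun σ => ?_⟩
    change pointEmb W F (f.1 (galRes k F σ)) = _
    have h : f.1 (galRes k F σ) = _ := hP (galRes k F σ)
    rw [h, map_sub, pointEmb_galAct])

end Cohomology

/-- The Tate–Shafarevich group of `W` over the number field `K`: the classes in `H¹(K, W)` that
become trivial in `H¹(K_v, W)` for every finite and every infinite place `v` of `K`. -/
def Sha {K : Type u} [Field K] [NumberField K] (W : WeierstrassCurve.Affine K) :
    AddSubgroup (H1 W K) :=
  (⨅ v : IsDedekindDomain.HeightOneSpectrum (NumberField.RingOfIntegers K),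
      (resH1 W (v.adicCompletion K)).ker) ⊓
    ⨅ v : NumberField.InfinitePlace K, (resH1 W v.Completion).ker

/-- The rational prime `p` splits completely in the number field `K`: there are `[K : ℚ]`
distinct primes of the ring of integers above `p`. -/
def SplitsCompletely (p : ℕ) (K : Type u) [Field K] [NumberField K] : Prop :=
  ((Ideal.span {(p : ℤ)}).primesOver (NumberField.RingOfIntegers K)).ncard = Module.finrank ℚ K

/-- The standing assumptions on a real quadratic field `K`, an odd prime `p` and one of the
curves `E i`. -/
structure Assumptions (K : Type u) [Field K] [NumberField K] (p : ℕ) [Fact p.Prime]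
    (i : Fin 2) : Prop where
  quadratic : Module.finrank ℚ K = 2
  totallyReal : NumberField.IsTotallyReal K
  odd : p ≠ 2
  ne_sqrt_five : IsEmpty (K ≃ₐ[ℚ] IntermediateField.adjoin ℚ {Real.sqrt 5})
  finite_points : Finite ((E i)⁄K).Point
  sha_trivial : AddCommGroup.primaryComponent (Sha ((E i)⁄K)) p = ⊥
  splits : SplitsCompletely p K

/-- `L` is the cyclotomic `ℤ_p`-extension of `K`: the Galois subextension `L` of `K(μ_{p^∞})`
whose Galois group over `K` is, as a topological group, isomorphic to `ℤ_p`. -/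
structure IsCyclotomicZpExtension {K : Type u} [Field K] (p : ℕ) [Fact p.Prime]
    (L : IntermediateField K (AlgebraicClosure K)) : Prop where
  le_cyclotomic : L ≤ IntermediateField.adjoin K {ζ : AlgebraicClosure K | ∃ n : ℕ, ζ ^ p ^ n = 1}
  isGalois : IsGalois K L
  galois_group : Nonempty (Gal(L/K) ≃ₜ* Multiplicative ℤ_[p])

end EllCurve

end

/-! Both sides are trivial: there are no points of odd prime order `l` over the cyclotomic
extension. By Galois descent it suffices to rule out odd torsion over `K` and to show that a nonzero
point of order `l` would produce one fixed by Galois.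

Over a quadratic field, work at a place above 2. The kernel of reduction has no odd torsion, so a
point of odd order has integral `x`, whose residue lies in the field with four elements. All
`b`-invariants are odd, so modulo the place doubling sends residues outside the prime field to 0,
sends 0 to 1, and is impossible at 1. Hence no such point exists
(`Point.eq_zero_of_odd_nsmul_eq_zero`).

If `l ≠ p`, use a place `v` above `p`. As `p` is a uniformizer at a place of `K`, the element `ζ -
1` generates a totally ramified extension, and an automorphism with `σ ζ = ζ ^ a`, `a ≡ 1` modulo
`p`, satisfies `v (σ w - w) < v w` for `w ≠ 0`. All of `Gal(L/K)` acts this way, being made of `(p -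
1)`-st powers. The 2-torsion is rational, so the estimate applies to each `x - e` with `e` the
abscissa of a 2-torsion point, and it forces `σ P - P` into the kernel of reduction
(`Point.inKernel_sub`), even when the curve has bad reduction at `p`. That kernel has no torsion
prime to `p`, so `σ P = P`.

If `l = p`, a topological generator acts unipotently on a point of order `p`, which yields a nonzero
fixed point of order `p` (`exists_fixed_of_iterate_prime_pow_eq`). -/

namespace Valuation

/-! ### Elementary estimates for valuations. -/

variable {F Γ : Type*} [Field F] [LinearOrderedCommGroupWithZero Γ] (v : Valuation F Γ)

theorem map_mul_le_mul {a b : F} {c d : Γ} (ha : v a ≤ c) (hb : v b ≤ d) : v (a * b) ≤ c * d := by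
  rw [map_mul]
  exact mul_le_mul' ha hb

theorem map_mul_le_of_le_one {a b : F} {d : Γ} (ha : v a ≤ 1) (hb : v b ≤ d) : v (a * b) ≤ d :=
  (v.map_mul_le_mul ha hb).trans_eq (one_mul d)

theorem map_mul_lt_of_le_one {a b : F} {d : Γ} (ha : v a ≤ 1) (hb : v b < d) : v (a * b) < d := by
  rw [map_mul]
  exact (mul_le_of_le_one_left' ha).trans_lt hb

theorem map_pow_le_pow {a : F} {c : Γ} (ha : v a ≤ c) (n : ℕ) : v (a ^ n) ≤ c ^ n := by
  rw [map_pow]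
  exact pow_le_pow_left' ha n

theorem map_natCast_le_one (n : ℕ) : v (n : F) ≤ 1 := by
  induction n with
  | zero => simp
  | succ n ih =>
    push_cast
    exact v.map_add_le ih v.map_one.le

theorem map_ofNat_le_one (n : ℕ) [n.AtLeastTwo] : v (ofNat(n) : F) ≤ 1 := by
  simpa using v.map_natCast_le_one (OfNat.ofNat n)

theorem map_intCast_le_one (n : ℤ) : v (n : F) ≤ 1 := by
  obtain ⟨n, rfl | rfl⟩ := n.eq_nat_or_neg
  · simpa using v.map_natCast_le_one n
  · simpa using v.map_natCast_le_one n

/-- Integers prime to an integer of value less than one have value one. -/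
theorem map_intCast_eq_one_of_isCoprime {m n : ℤ} (hm : v (m : F) < 1) (h : IsCoprime m n) :
    v (n : F) = 1 := by
  refine (v.map_intCast_le_one n).antisymm (not_lt.mp fun hn => ?_)
  obtain ⟨a, b, hab⟩ := h
  have h1 : v ((a : F) * m + b * n) < 1 :=
    v.map_add_lt (v.map_mul_lt_of_le_one (v.map_intCast_le_one a) hm)
      (v.map_mul_lt_of_le_one (v.map_intCast_le_one b) hn)
  rw [show (a : F) * m + b * n = 1 by exact_mod_cast congrArg (Int.cast (R := F)) hab] at h1
  simp at h1

end Valuation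

/-! ### Sizes of the coordinates on an integral Weierstrass equation. -/

namespace WeierstrassCurve.Affine

variable {F Γ : Type*} [Field F] [LinearOrderedCommGroupWithZero Γ] {v : Valuation F Γ}
  {W : WeierstrassCurve.Affine F}

variable (v W) in
/-- The coefficients of `W` are integral with respect to the valuation `v`. -/
structure IsIntegralAt : Prop where
  a₁ : v W.a₁ ≤ 1
  a₂ : v W.a₂ ≤ 1
  a₃ : v W.a₃ ≤ 1
  a₄ : v W.a₄ ≤ 1
  a₆ : v W.a₆ ≤ 1

/-- A point with nonintegral `x`-coordinate has `v y ^ 2 = v x ^ 3`. -/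
theorem IsIntegralAt.sq_val_y (hW : IsIntegralAt v W) {x y : F} (h : W.Equation x y)
    (hx : 1 < v x) : v y ^ 2 = v x ^ 3 := by
  have h23 : v x ^ 2 < v x ^ 3 := pow_lt_pow_right₀ hx (by norm_num)
  have h13 : v x < v x ^ 3 := lt_self_pow₀ hx (by norm_num)
  have h03 : 1 < v x ^ 3 := hx.trans h13
  have hR : v (x ^ 3 + W.a₂ * x ^ 2 + W.a₄ * x + W.a₆) = v x ^ 3 := by
    have h1 : v (W.a₂ * x ^ 2 + (W.a₄ * x + W.a₆)) < v x ^ 3 :=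
      v.map_add_lt (v.map_mul_lt_of_le_one hW.a₂ (by simpa using h23))
        (v.map_add_lt (v.map_mul_lt_of_le_one hW.a₄ h13) (hW.a₆.trans_lt h03))
    rw [show x ^ 3 + W.a₂ * x ^ 2 + W.a₄ * x + W.a₆ =
      x ^ 3 + (W.a₂ * x ^ 2 + (W.a₄ * x + W.a₆)) by ring, v.map_add_eq_of_lt_left (by simpa using h1),
      map_pow]
  have hL : v y * v (y + (W.a₁ * x + W.a₃)) = v x ^ 3 := by
    rw [← hR, ← (equation_iff _ _).mp h, ← map_mul]
    congr 1
    ring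
  have ha : v (W.a₁ * x + W.a₃) ≤ v x :=
    v.map_add_le (v.map_mul_le_of_le_one hW.a₁ le_rfl) (hW.a₃.trans hx.le)
  -- Otherwise the left side of the equation has value at most `v x ^ 2`, too small to match the
  -- dominant term `x ^ 3`. So `y` dominates its linear companion.
  have hy : v x < v y := by
    by_contra! hy
    have : v x ^ 3 ≤ v x ^ 2 := by
      rw [← hL, sq]
      exact mul_le_mul' hy (v.map_add_le hy ha)
    exact absurd this h23.not_ge
  rw [← hL, v.map_add_eq_of_lt_left (ha.trans_lt hy), sq]

/-- A point with integral `x`-coordinate has integral `y`-coordinate. -/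
theorem IsIntegralAt.val_y_le_one (hW : IsIntegralAt v W) {x y : F} (h : W.Equation x y)
    (hx : v x ≤ 1) : v y ≤ 1 := by
  by_contra! hy
  have ha : v (W.a₁ * x + W.a₃) ≤ 1 :=
    v.map_add_le (v.map_mul_le_of_le_one hW.a₁ hx) hW.a₃
  have hR : v (x ^ 3 + W.a₂ * x ^ 2 + W.a₄ * x + W.a₆) ≤ 1 :=
    v.map_add_le (v.map_add_le (v.map_add_le (by simpa using pow_le_one' hx 3)
      (v.map_mul_le_of_le_one hW.a₂ (by simpa using pow_le_one' hx 2)))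
      (v.map_mul_le_of_le_one hW.a₄ hx)) hW.a₆
  rw [← (equation_iff _ _).mp h, show y ^ 2 + W.a₁ * x * y + W.a₃ * y =
    y * (y + (W.a₁ * x + W.a₃)) by ring, map_mul, v.map_add_eq_of_lt_left (ha.trans_lt hy)] at hR
  exact absurd hR (one_lt_mul'' hy hy).not_ge

end WeierstrassCurve.Affine

/-! ### The group law near infinity, in the coordinates `t = x / y`, `s = 1 / y`. -/

namespace WeierstrassCurve.Affine

variable {F Γ : Type*} [Field F] [LinearOrderedCommGroupWithZero Γ] {v : Valuation F Γ}
  {W : WeierstrassCurve.Affine F}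

theorem IsIntegralAt.y_ne_zero (hW : IsIntegralAt v W) {x y : F} (h : W.Equation x y)
    (hx : 1 < v x) : y ≠ 0 := by
  rintro rfl
  have := hW.sq_val_y h hx
  rw [map_zero, zero_pow two_ne_zero] at this
  exact (pow_ne_zero 3 (zero_lt_one.trans hx).ne') this.symm

theorem IsIntegralAt.val_inv_x (hW : IsIntegralAt v W) {x y : F} (h : W.Equation x y)
    (hx : 1 < v x) : v x⁻¹ = v (x / y) ^ 2 := by
  have hx0 : v x ≠ 0 := (zero_lt_one.trans hx).ne'
  rw [map_div₀, div_pow, hW.sq_val_y h hx, map_inv₀]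
  field_simp

theorem IsIntegralAt.val_inv_y (hW : IsIntegralAt v W) {x y : F} (h : W.Equation x y)
    (hx : 1 < v x) : v y⁻¹ = v (x / y) ^ 3 := by
  have hy0 : v y ≠ 0 := v.ne_zero_iff.mpr (hW.y_ne_zero h hx)
  rw [map_div₀, div_pow, ← hW.sq_val_y h hx, map_inv₀]
  field_simp

theorem IsIntegralAt.val_x_div_y_lt_one (hW : IsIntegralAt v W) {x y : F} (h : W.Equation x y)
    (hx : 1 < v x) : v (x / y) < 1 := by
  by_contra! ht
  have h1 : v x⁻¹ < 1 := (v.one_lt_val_iff (v.pos_iff.mp (zero_lt_one.trans hx))).mp hx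
  rw [hW.val_inv_x h hx] at h1
  exact absurd (one_le_pow_of_one_le' ht 2) h1.not_ge

/-- The equation of a Weierstrass curve in the coordinates `t = x / y` and `s = 1 / y`. -/
theorem equation_div_y {x y : F} (h : W.Equation x y) (hy : y ≠ 0) :
    y⁻¹ + W.a₁ * (x / y) * y⁻¹ + W.a₃ * y⁻¹ ^ 2 =
      (x / y) ^ 3 + W.a₂ * (x / y) ^ 2 * y⁻¹ + W.a₄ * (x / y) * y⁻¹ ^ 2 + W.a₆ * y⁻¹ ^ 3 := by
  have h := (equation_iff _ _).mp h
  field_simp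
  linear_combination h

/-- Two points with nonintegral coordinates have proportional differences of `s = 1 / y` and
`t = x / y`, with a small factor. -/
theorem IsIntegralAt.exists_sub_eq_mul_sub (hW : IsIntegralAt v W) {t₁ t₂ s₁ s₂ : F} {r : Γ}
    (hr : r < 1)
    (h₁ : s₁ + W.a₁ * t₁ * s₁ + W.a₃ * s₁ ^ 2 =
      t₁ ^ 3 + W.a₂ * t₁ ^ 2 * s₁ + W.a₄ * t₁ * s₁ ^ 2 + W.a₆ * s₁ ^ 3)
    (h₂ : s₂ + W.a₁ * t₂ * s₂ + W.a₃ * s₂ ^ 2 =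
      t₂ ^ 3 + W.a₂ * t₂ ^ 2 * s₂ + W.a₄ * t₂ * s₂ ^ 2 + W.a₆ * s₂ ^ 3)
    (ht₁ : v t₁ ≤ r) (ht₂ : v t₂ ≤ r) (hs₁ : v s₁ ≤ r ^ 3) (hs₂ : v s₂ ≤ r ^ 3) :
    ∃ α, v α ≤ r ^ 2 ∧ s₂ - s₁ = α * (t₂ - t₁) := by
  have h2r : r ^ 2 ≤ r := pow_le_of_le_one zero_le hr.le two_ne_zero
  have h32 : r ^ 3 ≤ r ^ 2 := pow_le_pow_right_of_le_one' hr.le (by norm_num)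
  have h31 : r ^ 3 ≤ 1 := pow_le_one' hr.le 3
  -- Subtract the two equations and split each difference of monomials into a multiple of `t₂ - t₁`,
  -- collected in `N`, and a multiple of `s₂ - s₁`, collected in `1 + D`. Then `1 + D` is a unit and
  -- `N` has order two.
  set N := t₁ ^ 2 + t₁ * t₂ + t₂ ^ 2 + W.a₂ * ((t₁ + t₂) * s₁) + W.a₄ * (s₁ * s₁) - W.a₁ * s₁ with hN
  set D := W.a₁ * t₂ + W.a₃ * (s₁ + s₂) - W.a₂ * (t₂ * t₂) - W.a₄ * (t₂ * (s₁ + s₂)) -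
    W.a₆ * (s₁ * s₁ + s₁ * s₂ + s₂ * s₂) with hD
  have key : (s₂ - s₁) * (1 + D) = N * (t₂ - t₁) := by
    rw [hN, hD]
    linear_combination h₂ - h₁
  have t1 := ht₁.trans hr.le
  have t2 := ht₂.trans hr.le
  have s1 := hs₁.trans h31
  have s2 := hs₂.trans h31
  have s1r := hs₁.trans (h32.trans h2r)
  have s2r := hs₂.trans (h32.trans h2r)
  have s12 : v (s₁ + s₂) ≤ r := v.map_add_le s1r s2r
  have hNv : v N ≤ r ^ 2 := by
    refine v.map_sub_le (v.map_add_le (v.map_add_le (v.map_add_le (v.map_add_le ?_ ?_) ?_) ?_) ?_) ?_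
    · exact v.map_pow_le_pow ht₁ 2
    · exact (v.map_mul_le_mul ht₁ ht₂).trans_eq (sq r).symm
    · exact v.map_pow_le_pow ht₂ 2
    · exact v.map_mul_le_of_le_one hW.a₂
        (v.map_mul_le_of_le_one (v.map_add_le t1 t2) (hs₁.trans h32))
    · exact v.map_mul_le_of_le_one hW.a₄ (v.map_mul_le_of_le_one s1 (hs₁.trans h32))
    · exact v.map_mul_le_of_le_one hW.a₁ (hs₁.trans h32)
  have hDv : v D ≤ r := by
    refine v.map_sub_le (v.map_sub_le (v.map_sub_le (v.map_add_le ?_ ?_) ?_) ?_) ?_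
    · exact v.map_mul_le_of_le_one hW.a₁ ht₂
    · exact v.map_mul_le_of_le_one hW.a₃ s12
    · exact v.map_mul_le_of_le_one hW.a₂ (v.map_mul_le_of_le_one t2 ht₂)
    · exact v.map_mul_le_of_le_one hW.a₄ (v.map_mul_le_of_le_one t2 s12)
    · exact v.map_mul_le_of_le_one hW.a₆ (v.map_add_le (v.map_add_le
        (v.map_mul_le_of_le_one s1 s1r) (v.map_mul_le_of_le_one s1 s2r))
        (v.map_mul_le_of_le_one s2 s2r))
  have hD1 : v (1 + D) = 1 := v.map_one_add_of_lt (hDv.trans_lt hr)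
  have hD0 : 1 + D ≠ 0 := v.ne_zero_iff.mp (hD1 ▸ one_ne_zero)
  refine ⟨N / (1 + D), by rwa [map_div₀, hD1, div_one], ?_⟩
  field_simp
  linear_combination key

/-- Since `negY = -y (1 + a₁ t + a₃ s)`, negation on the curve is `t ↦ -t` up to second order. -/
theorem IsIntegralAt.val_div_negY_add_le (hW : IsIntegralAt v W) {x y : F}
    (h : W.Equation x y) (hx : 1 < v x) : v (x / W.negY x y + x / y) ≤ v (x / y) ^ 2 := by
  have hy := hW.y_ne_zero h hx
  have ht := hW.val_x_div_y_lt_one h hx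
  have hs : v y⁻¹ ≤ v (x / y) := by
    rw [hW.val_inv_y h hx]
    exact pow_le_of_le_one zero_le ht.le (by norm_num)
  have hD : v (W.a₁ * (x / y) + W.a₃ * y⁻¹) ≤ v (x / y) :=
    v.map_add_le (v.map_mul_le_of_le_one hW.a₁ le_rfl) (v.map_mul_le_of_le_one hW.a₃ hs)
  have hD1 : v (1 + (W.a₁ * (x / y) + W.a₃ * y⁻¹)) = 1 := v.map_one_add_of_lt (hD.trans_lt ht)
  have hD0 : 1 + (W.a₁ * (x / y) + W.a₃ * y⁻¹) ≠ 0 := v.ne_zero_iff.mp (hD1 ▸ one_ne_zero)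
  have hn : W.negY x y = - y * (1 + (W.a₁ * (x / y) + W.a₃ * y⁻¹)) := by
    rw [negY]; field_simp; ring
  have : x / W.negY x y + x / y = (x / y) * (W.a₁ * (x / y) + W.a₃ * y⁻¹) /
      (1 + (W.a₁ * (x / y) + W.a₃ * y⁻¹)) := by
    rw [hn]
    generalize W.a₁ * (x / y) + W.a₃ * y⁻¹ = D at hD0
    field_simp
    ring
  rw [this, map_div₀, hD1, div_one, map_mul, sq]
  exact mul_le_mul_right hD _

variable [DecidableEq F]

/-- The line through two points with nonintegral coordinates, written as `α * x + β * y = 1`. -/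
theorem IsIntegralAt.exists_line (hW : IsIntegralAt v W) {x₁ y₁ x₂ y₂ : F} {r : Γ} (hr : r < 1)
    (h₁ : W.Equation x₁ y₁) (h₂ : W.Equation x₂ y₂) (hx₁ : 1 < v x₁) (hx₂ : 1 < v x₂)
    (ht₁ : v (x₁ / y₁) ≤ r) (ht₂ : v (x₂ / y₂) ≤ r) (hxy : ¬(x₁ = x₂ ∧ y₁ = W.negY x₂ y₂)) :
    ∃ α β, v α ≤ r ^ 2 ∧ v β ≤ r ^ 2 ∧ β ≠ 0 ∧ α * x₁ + β * y₁ = 1 ∧ α * x₂ + β * y₂ = 1 ∧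
      W.slope x₁ x₂ y₁ y₂ = -α / β := by
  have h32 : r ^ 3 ≤ r ^ 2 := pow_le_pow_right_of_le_one' hr.le (by norm_num)
  have hy₁ := hW.y_ne_zero h₁ hx₁
  have hy₂ := hW.y_ne_zero h₂ hx₂
  have hs₁ : v y₁⁻¹ ≤ r ^ 3 := (hW.val_inv_y h₁ hx₁).trans_le (pow_le_pow_left' ht₁ 3)
  have hs₂ : v y₂⁻¹ ≤ r ^ 3 := (hW.val_inv_y h₂ hx₂).trans_le (pow_le_pow_left' ht₂ 3)
  by_cases hx : x₁ = x₂
  · have hy : y₁ ≠ W.negY x₂ y₂ := fun h => hxy ⟨hx, h⟩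
    obtain ⟨rfl, rfl⟩ : x₁ = x₂ ∧ y₁ = y₂ := ⟨hx, Y_eq_of_Y_ne h₁ h₂ hx hy⟩
    have hx0 : x₁ ≠ 0 := v.pos_iff.mp (zero_lt_one.trans hx₁)
    have h₁' := (equation_iff _ _).mp h₁
    rw [slope_of_Y_ne rfl hy]
    have hδ : y₁ - W.negY x₁ y₁ ≠ 0 := sub_ne_zero.mpr hy
    set δ := y₁ - W.negY x₁ y₁ with hδ'
    -- The tangent is `N x₁² X - δ Y = (1 + D) x₁³`: `N` and `1 + D` are the numerator of the slope
    -- and the constant term, stripped of their leading powers of `x₁`. Dividing by the right side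
    -- gives `α` and `β`.
    set N := 3 + 2 * (W.a₂ * x₁⁻¹) + W.a₄ * (x₁⁻¹ * x₁⁻¹) - W.a₁ * (x₁⁻¹ * (x₁ / y₁)⁻¹) with hN
    set D := - (W.a₄ * (x₁⁻¹ * x₁⁻¹)) - 2 * (W.a₆ * (x₁⁻¹ * x₁⁻¹ * x₁⁻¹)) +
      W.a₃ * (x₁⁻¹ * (x₁⁻¹ * (x₁ / y₁)⁻¹)) with hD
    have hxi : v x₁⁻¹ ≤ r ^ 2 := (hW.val_inv_x h₁ hx₁).trans_le (pow_le_pow_left' ht₁ 2)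
    have hxi1 : v x₁⁻¹ < 1 := (v.one_lt_val_iff hx0).mp hx₁
    have hxt : v (x₁⁻¹ * (x₁ / y₁)⁻¹) = v (x₁ / y₁) := by
      have : v (x₁ / y₁) ≠ 0 := v.ne_zero_iff.mpr (div_ne_zero hx0 hy₁)
      rw [map_mul, hW.val_inv_x h₁ hx₁, map_inv₀]
      field_simp
    have ht1 : v (x₁ / y₁) < 1 := hW.val_x_div_y_lt_one h₁ hx₁
    have hNv : v N ≤ 1 := by
      refine v.map_sub_le (v.map_add_le (v.map_add_le (v.map_ofNat_le_one 3) ?_) ?_) ?_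
      · exact v.map_mul_le_of_le_one (v.map_ofNat_le_one 2)
          (v.map_mul_le_of_le_one hW.a₂ hxi1.le)
      · exact v.map_mul_le_of_le_one hW.a₄ (v.map_mul_le_of_le_one hxi1.le hxi1.le)
      · exact v.map_mul_le_of_le_one hW.a₁ (hxt.trans_le ht1.le)
    have hDv : v D < 1 := by
      refine v.map_add_lt (v.map_sub_lt ?_ ?_) ?_
      · rw [v.map_neg]
        exact v.map_mul_lt_of_le_one hW.a₄ (v.map_mul_lt_of_le_one hxi1.le hxi1)
      · exact v.map_mul_lt_of_le_one (v.map_ofNat_le_one 2) (v.map_mul_lt_of_le_one hW.a₆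
          (v.map_mul_lt_of_le_one (v.map_mul_le_of_le_one hxi1.le hxi1.le) hxi1))
      · exact v.map_mul_lt_of_le_one hW.a₃ (v.map_mul_lt_of_le_one hxi1.le (hxt.trans_lt ht1))
    have hD1 : v (1 + D) = 1 := v.map_one_add_of_lt hDv
    have hD0 : 1 + D ≠ 0 := v.ne_zero_iff.mp (hD1 ▸ one_ne_zero)
    have hα : v (x₁⁻¹ * (N / (1 + D))) ≤ r ^ 2 := by
      rw [mul_comm]
      exact v.map_mul_le_of_le_one (by rwa [map_div₀, hD1, div_one]) hxi
    have hNx : N * x₁ ^ 2 = 3 * x₁ ^ 2 + 2 * W.a₂ * x₁ + W.a₄ - W.a₁ * y₁ := by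
      rw [hN]; field_simp
    have hDx : (1 + D) * x₁ ^ 3 = x₁ ^ 3 - W.a₄ * x₁ - 2 * W.a₆ + W.a₃ * y₁ := by
      rw [hD]; field_simp; ring
    have hδe : δ = 2 * y₁ + W.a₁ * x₁ + W.a₃ := by rw [hδ', negY]; ring
    have hβe : - δ / ((1 + D) * x₁ ^ 3) = (1 - x₁⁻¹ * (N / (1 + D)) * x₁) * y₁⁻¹ := by
      have : -δ * y₁ = (1 + D) * x₁ ^ 3 - N * x₁ ^ 2 * x₁ := by
        rw [hNx, hDx, hδe]; linear_combination (-2) * h₁'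
      field_simp
      linear_combination this
    have hline : x₁⁻¹ * (N / (1 + D)) * x₁ + - δ / ((1 + D) * x₁ ^ 3) * y₁ = 1 := by
      rw [hβe]; field_simp; ring
    refine ⟨x₁⁻¹ * (N / (1 + D)), - δ / ((1 + D) * x₁ ^ 3), hα, ?_, ?_, hline, hline, ?_⟩
    · rw [hβe]
      refine v.map_mul_le_of_le_one (v.map_sub_le v.map_one.le ?_) (hs₁.trans h32)
      rw [mul_comm, mul_inv_cancel_left₀ hx0, map_div₀, hD1, div_one]
      exact hNv
    · exact div_ne_zero (neg_ne_zero.mpr hδ) (mul_ne_zero hD0 (pow_ne_zero 3 hx0))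
    · rw [← hNx]
      field_simp
  -- For distinct abscissae the line is `s = α t + β` with `β = s₁ - α t₁`; multiplying by `y` gives
  -- `α x + β y = 1`.
  · obtain ⟨α, hα, hs⟩ := hW.exists_sub_eq_mul_sub hr (equation_div_y h₁ hy₁)
      (equation_div_y h₂ hy₂) ht₁ ht₂ hs₁ hs₂
    have hl₁ : α * x₁ + (y₁⁻¹ - α * (x₁ / y₁)) * y₁ = 1 := by field_simp; ring
    have hl₂ : α * x₂ + (y₁⁻¹ - α * (x₁ / y₁)) * y₂ = 1 := by
      have : y₁⁻¹ - α * (x₁ / y₁) = y₂⁻¹ - α * (x₂ / y₂) := by linear_combination -hs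
      rw [this]; field_simp; ring
    have hβ : y₁⁻¹ - α * (x₁ / y₁) ≠ 0 := by
      intro h0
      rw [h0, zero_mul, add_zero] at hl₁ hl₂
      have hα0 : α ≠ 0 := by rintro rfl; simp at hl₁
      exact hx (mul_left_cancel₀ hα0 (hl₁.trans hl₂.symm))
    refine ⟨α, _, hα, v.map_sub_le (hs₁.trans h32) ?_, hβ, hl₁, hl₂, ?_⟩
    · rw [mul_comm]
      exact v.map_mul_le_of_le_one (ht₁.trans hr.le) hα
    · rw [slope_of_X_ne hx, div_eq_div_iff (sub_ne_zero.mpr hx) hβ]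
      linear_combination hl₁ - hl₂

/-- The sum of the values of `x / y` at the three intersection points with a line is small. -/
theorem IsIntegralAt.val_add_add_le (hW : IsIntegralAt v W) {x₁ y₁ x₂ y₂ : F} {r : Γ} (hr : r < 1)
    (h₁ : W.Equation x₁ y₁) (h₂ : W.Equation x₂ y₂) (hx₁ : 1 < v x₁) (hx₂ : 1 < v x₂)
    (ht₁ : v (x₁ / y₁) ≤ r) (ht₂ : v (x₂ / y₂) ≤ r) (hxy : ¬(x₁ = x₂ ∧ y₁ = W.negY x₂ y₂)) {x₃ y₃ : F}
    (hx₃ : x₃ = W.addX x₁ x₂ (W.slope x₁ x₂ y₁ y₂))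
    (hy₃ : y₃ = W.negAddY x₁ x₂ y₁ (W.slope x₁ x₂ y₁ y₂)) :
    1 < v x₃ ∧ v (x₁ / y₁ + x₂ / y₂ + x₃ / y₃) ≤ r ^ 2 := by
  have h2r : r ^ 2 ≤ r := pow_le_of_le_one zero_le hr.le two_ne_zero
  obtain ⟨α, β, hα, hβ, hβ0, hl₁, hl₂, hs⟩ := hW.exists_line hr h₁ h₂ hx₁ hx₂ ht₁ ht₂ hxy
  have hα1 := hα.trans (h2r.trans hr.le)
  have e₃ : W.Equation x₃ y₃ := by
    rw [hx₃, hy₃]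
    exact equation_negAdd h₁ h₂ hxy
  -- The cubic cut out by the line has the three abscissae as roots; its coefficients give their
  -- elementary symmetric functions.
  have hpoly := addPolynomial_slope h₁ h₂ hxy
  rw [addPolynomial_eq, neg_inj, Cubic.prod_X_sub_C_eq, Cubic.toPoly_injective, ← hx₃, hs,
    Cubic.mk.injEq] at hpoly
  obtain ⟨-, c₁, c₂, c₃⟩ := hpoly
  have hy₁e : y₁ = (1 - α * x₁) / β := by field_simp; linear_combination hl₁
  have hy₂e : y₂ = (1 - α * x₂) / β := by field_simp; linear_combination hl₂
  have hy₃e : y₃ = (1 - α * x₃) / β := by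
    rw [hy₃, negAddY, ← hx₃, hs, hy₁e]; field_simp; ring
  rw [hy₁e] at c₂ c₃
  -- Substituting `s = α t + β` in the curve gives a cubic in `t` with leading coefficient `1 + A`
  -- and quadratic coefficient `B`, so the sum of the three values of `t` is `-B / (1 + A)`.
  set A := W.a₂ * α + W.a₄ * (α * α) + W.a₆ * (α * α * α) with hA
  set B := W.a₂ * β + 2 * (W.a₄ * (α * β)) + 3 * (W.a₆ * (α * α * β)) - W.a₁ * α - W.a₃ * (α * α)
    with hB
  have hAv : v A < 1 := by
    have : v α < 1 := hα.trans_lt (h2r.trans_lt hr)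
    refine v.map_add_lt (v.map_add_lt ?_ ?_) ?_
    · exact v.map_mul_lt_of_le_one hW.a₂ this
    · exact v.map_mul_lt_of_le_one hW.a₄ (v.map_mul_lt_of_le_one hα1 this)
    · exact v.map_mul_lt_of_le_one hW.a₆
        (v.map_mul_lt_of_le_one (v.map_mul_le_of_le_one hα1 hα1) this)
  have hBv : v B ≤ r ^ 2 := by
    refine v.map_sub_le (v.map_sub_le (v.map_add_le (v.map_add_le ?_ ?_) ?_) ?_) ?_
    · exact v.map_mul_le_of_le_one hW.a₂ hβ
    · exact v.map_mul_le_of_le_one (v.map_ofNat_le_one 2) (v.map_mul_le_of_le_one hW.a₄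
        (v.map_mul_le_of_le_one hα1 hβ))
    · exact v.map_mul_le_of_le_one (v.map_ofNat_le_one 3) (v.map_mul_le_of_le_one hW.a₆
        (v.map_mul_le_of_le_one (v.map_mul_le_of_le_one hα1 hα1) hβ))
    · exact v.map_mul_le_of_le_one hW.a₁ hα
    · exact v.map_mul_le_of_le_one hW.a₃ (v.map_mul_le_of_le_one hα1 hα)
  have hA1 : v (1 + A) = 1 := v.map_one_add_of_lt hAv
  have hA0 : 1 + A ≠ 0 := v.ne_zero_iff.mp (hA1 ▸ one_ne_zero)
  have d₁ : x₁ + x₂ + x₃ = (-α / β) ^ 2 + W.a₁ * (-α / β) - W.a₂ := by linear_combination c₁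
  have d₂ : x₁ * x₂ + x₁ * x₃ + x₂ * x₃ = W.a₄ + 2 * α / β ^ 2 - W.a₁ / β + W.a₃ * α / β := by
    rw [← c₂]; field_simp; ring
  have d₃ : x₁ * x₂ * x₃ = 1 / β ^ 2 + W.a₃ / β - W.a₆ := by
    rw [← neg_inj, ← c₃]; field_simp; ring
  -- As `1 - α x = β y` on the line, this unit shows that no `y` vanishes, so every `t` is defined.
  have hprod : (1 - α * x₁) * (1 - α * x₂) * (1 - α * x₃) = 1 + A := by
    rw [show (1 - α * x₁) * (1 - α * x₂) * (1 - α * x₃) = 1 - α * (x₁ + x₂ + x₃) +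
      α ^ 2 * (x₁ * x₂ + x₁ * x₃ + x₂ * x₃) - α ^ 3 * (x₁ * x₂ * x₃) by ring, d₁, d₂, d₃, hA]
    field_simp
    ring
  have hne := hprod ▸ hA0
  have n₁ : 1 - α * x₁ ≠ 0 := fun h => hne (by rw [h]; ring)
  have n₂ : 1 - α * x₂ ≠ 0 := fun h => hne (by rw [h]; ring)
  have n₃ : 1 - α * x₃ ≠ 0 := fun h => hne (by rw [h]; ring)
  have hsum : x₁ / y₁ + x₂ / y₂ + x₃ / y₃ = -B / (1 + A) := by
    have h3 : x₁ / y₁ + x₂ / y₂ + x₃ / y₃ = β * ((x₁ + x₂ + x₃) -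
        2 * α * (x₁ * x₂ + x₁ * x₃ + x₂ * x₃) + 3 * α ^ 2 * (x₁ * x₂ * x₃)) /
        ((1 - α * x₁) * (1 - α * x₂) * (1 - α * x₃)) := by
      rw [hy₁e, hy₂e, hy₃e, div_div_eq_mul_div, div_div_eq_mul_div, div_div_eq_mul_div,
        div_add_div _ _ n₁ n₂, div_add_div _ _ (mul_ne_zero n₁ n₂) n₃]
      congr 1
      ring
    rw [h3, hprod, d₁, d₂, d₃, hB]
    congr 1
    field_simp
    ring
  have hle : v (x₁ / y₁ + x₂ / y₂ + x₃ / y₃) ≤ r ^ 2 := by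
    rw [hsum, map_div₀, hA1, div_one, v.map_neg]
    exact hBv
  refine ⟨?_, hle⟩
  have ht₃ : v (x₃ / y₃) ≤ r := by
    rw [show x₃ / y₃ = (x₁ / y₁ + x₂ / y₂ + x₃ / y₃) - (x₁ / y₁ + x₂ / y₂) by ring]
    exact v.map_sub_le (hle.trans h2r) (v.map_add_le ht₁ ht₂)
  have hy₃0 : y₃ ≠ 0 := by
    rw [hy₃e]
    exact div_ne_zero n₃ hβ0
  have hs₃ : v y₃⁻¹ < 1 := by
    have : y₃⁻¹ = α * (x₃ / y₃) + β := by rw [hy₃e]; field_simp; ring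
    rw [this]
    exact (v.map_add_le (v.map_mul_le_of_le_one hα1 ht₃) (hβ.trans h2r)).trans_lt hr
  by_contra! hx
  have h1 := hW.val_y_le_one e₃ hx
  exact absurd h1 ((v.one_lt_val_iff hy₃0).mpr hs₃).not_ge

end WeierstrassCurve.Affine

/-! ### The kernel of reduction and its torsion. -/

namespace WeierstrassCurve.Affine

variable {F Γ : Type*} [Field F] [LinearOrderedCommGroupWithZero Γ] {v : Valuation F Γ}
  {W : WeierstrassCurve.Affine F}

namespace Point

/-- The local parameter `x / y` at the point at infinity. -/
noncomputable def localParam : W.Point → F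
  | zero => 0
  | some x y _ => x / y

variable (v) in
/-- The point at infinity and the points with nonintegral `x`-coordinate, that is, the kernel of
the reduction at `v`. -/
def InKernel : W.Point → Prop
  | zero => True
  | some x _ _ => 1 < v x

variable [DecidableEq F]

/-- Three points on a line have `t`-values summing to zero up to second order, and negation reverses
the sign of `t` to the same order. So `t` is additive modulo `r ^ 2`. -/
theorem inKernel_add (hW : IsIntegralAt v W) {P Q : W.Point} {r : Γ} (hr : r < 1)
    (hP : P.InKernel v) (hQ : Q.InKernel v) (hPr : v P.localParam ≤ r) (hQr : v Q.localParam ≤ r) :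
    (P + Q).InKernel v ∧ v ((P + Q).localParam - (P.localParam + Q.localParam)) ≤ r ^ 2 := by
  rcases P with _ | ⟨x₁, y₁, h₁⟩
  · rw [← zero_def, zero_add]
    exact ⟨hQ, by simp [localParam]⟩
  rcases Q with _ | ⟨x₂, y₂, h₂⟩
  · rw [← zero_def, add_zero]
    exact ⟨hP, by simp [localParam]⟩
  simp only [InKernel] at hP hQ
  simp only [localParam] at hPr hQr
  by_cases hxy : x₁ = x₂ ∧ y₁ = W.negY x₂ y₂
  · rw [add_of_Y_eq hxy.1 hxy.2]
    refine ⟨trivial, ?_⟩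
    obtain ⟨rfl, rfl⟩ := hxy
    simp only [localParam, zero_sub, Valuation.map_neg]
    exact (hW.val_div_negY_add_le h₂.1 hQ).trans (pow_le_pow_left' hQr 2)
  · obtain ⟨hx, hle⟩ := hW.val_add_add_le hr h₁.1 h₂.1 hP hQ hPr hQr hxy rfl rfl
    rw [add_some hxy]
    refine ⟨hx, ?_⟩
    have e₃ := equation_negAdd h₁.1 h₂.1 hxy
    have ht := hW.val_div_negY_add_le e₃ hx
    simp only [localParam, addY]
    set x₃ := W.addX x₁ x₂ (W.slope x₁ x₂ y₁ y₂)
    set y₃ := W.negAddY x₁ x₂ y₁ (W.slope x₁ x₂ y₁ y₂)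
    have h2r : r ^ 2 ≤ r := pow_le_of_le_one zero_le hr.le two_ne_zero
    have ht₃ : v (x₃ / y₃) ≤ r := by
      rw [show x₃ / y₃ = (x₁ / y₁ + x₂ / y₂ + x₃ / y₃) - (x₁ / y₁ + x₂ / y₂) by ring]
      exact v.map_sub_le (hle.trans h2r) (v.map_add_le hPr hQr)
    rw [show x₃ / W.negY x₃ y₃ - (x₁ / y₁ + x₂ / y₂) =
      (x₃ / W.negY x₃ y₃ + x₃ / y₃) - (x₁ / y₁ + x₂ / y₂ + x₃ / y₃) by ring]
    exact v.map_sub_le (ht.trans (pow_le_pow_left' ht₃ 2)) hle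

/-- Points of the kernel of reduction have no torsion prime to the residue characteristic. -/
theorem eq_zero_of_inKernel_of_nsmul_eq_zero (hW : IsIntegralAt v W) {P : W.Point}
    (hP : P.InKernel v) {n : ℕ} (hn : v (n : F) = 1) (h : n • P = 0) : P = 0 := by
  rcases P with _ | ⟨x, y, hxy⟩
  · rfl
  exfalso
  have hx : 1 < v x := hP
  set P : W.Point := some x y hxy
  have ht : P.localParam = x / y := rfl
  have hr := hW.val_x_div_y_lt_one hxy.1 hx
  rw [← ht] at hr
  -- Modulo second order `t (m P) = m t (P)`. For `m = n`, a unit, this reads `v t ≤ v t ^ 2`,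
  -- impossible when `0 < v t < 1`.
  have key (m : ℕ) : (m • P).InKernel v ∧
      v ((m • P).localParam - m * P.localParam) ≤ v P.localParam ^ 2 := by
    induction m with
    | zero =>
      rw [zero_smul]
      exact ⟨trivial, by simp [localParam]⟩
    | succ m ih =>
      have h2r : v P.localParam ^ 2 ≤ v P.localParam := pow_le_of_le_one zero_le hr.le two_ne_zero
      have hm : v (m • P).localParam ≤ v P.localParam := by
        rw [← sub_add_cancel (m • P).localParam (m * P.localParam)]
        exact v.map_add_le (ih.2.trans h2r)
          (v.map_mul_le_of_le_one (v.map_natCast_le_one m) le_rfl)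
      obtain ⟨h1, h2⟩ := inKernel_add hW hr ih.1 hP hm le_rfl
      rw [add_smul, one_smul]
      refine ⟨h1, ?_⟩
      rw [show (m • P + P).localParam - ((m + 1 : ℕ) : F) * P.localParam =
        ((m • P + P).localParam - ((m • P).localParam + P.localParam)) +
          ((m • P).localParam - m * P.localParam) by push_cast; ring]
      exact v.map_add_le h2 ih.2
  have h1 := (key n).2
  rw [h, zero_def, show (zero : W.Point).localParam = 0 from rfl, zero_sub, v.map_neg, map_mul, hn,
    one_mul] at h1
  have h0 : 0 < v P.localParam := by
    rw [ht]
    exact v.pos_iff.mpr (div_ne_zero (v.pos_iff.mp (zero_lt_one.trans hx)) (hW.y_ne_zero hxy.1 hx))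
  exact absurd h1 (pow_lt_self_of_lt_one₀ h0 hr (by norm_num)).not_ge

/-- Two points that are close to each other with respect to the three points of order two differ
by a point of the kernel of reduction. -/
theorem inKernel_sub (hW : IsIntegralAt v W) (h2 : v (2 : F) = 1) {e₁ e₂ e₃ : F}
    (he₁ : v e₁ ≤ 1) (he : v (e₁ - e₂) = 1)
    (hfac : ∀ x, 4 * x ^ 3 + W.b₂ * x ^ 2 + 2 * W.b₄ * x + W.b₆ =
      4 * ((x - e₁) * (x - e₂) * (x - e₃)))
    {x y x' y' : F} (h : W.Nonsingular x y) (h' : W.Nonsingular x' y')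
    (hx₁ : v (x' - x) < v (x - e₁)) (hx₂ : v (x' - x) < v (x - e₂)) (hx₃ : v (x' - x) < v (x - e₃))
    (hy : v ((y' - W.negY x' y') - (y - W.negY x y)) < v (y - W.negY x y)) :
    (some x' y' h' - some x y h).InKernel v := by
  have h20 : (2 : F) ≠ 0 := v.ne_zero_iff.mp (h2 ▸ one_ne_zero)
  have h4 : v (4 : F) = 1 := by
    rw [show (4 : F) = 2 * 2 by norm_num, map_mul, h2, one_mul]
  have hsq {x y : F} (h : W.Nonsingular x y) :
      (y - W.negY x y) ^ 2 = 4 * ((x - e₁) * (x - e₂) * (x - e₃)) := by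
    rw [← hfac, negY, b₂, b₄, b₆]
    linear_combination 4 * (equation_iff _ _).mp h.1
  -- With `Y = y - negY = 2 y + a₁ x + a₃`, the two values of `Y` are close and 2 is a unit, so
  -- their sum has the size of `Y`; in particular they are not opposite.
  have hY : v (y' - W.negY x' y' + (y - W.negY x y)) = v (y - W.negY x y) := by
    rw [show y' - W.negY x' y' + (y - W.negY x y) =
      2 * (y - W.negY x y) + ((y' - W.negY x' y') - (y - W.negY x y)) by ring,
      v.map_add_eq_of_lt_left, map_mul, h2, one_mul]
    rwa [map_mul, h2, one_mul]
  rw [sub_eq_add_neg, neg_some]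
  by_cases hx : x' = x
  · subst hx
    have hYY : y' = y := by
      have h1 : (y' - W.negY x' y' - (y - W.negY x' y)) *
          (y' - W.negY x' y' + (y - W.negY x' y)) = 0 := by
        linear_combination hsq h' - hsq h
      rcases mul_eq_zero.mp h1 with h1 | h1
      · simp only [negY] at h1
        exact mul_left_cancel₀ h20 (by linear_combination h1)
      · rw [h1, v.map_zero] at hY
        rw [← hY] at hy
        simp at hy
    subst hYY
    rw [add_of_Y_eq rfl (negY_negY x' y').symm]
    trivial
  · rw [add_of_X_ne hx]
    change 1 < v _
    rw [slope_of_X_ne hx]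
    have hxx : x' - x ≠ 0 := sub_ne_zero.mpr hx
    set d := x' - x with hd
    set s := (y' - W.negY x y) / d with hs
    set Y := y - W.negY x y with hYd
    -- `Λ` is the slope from the negative of the second point to the first in the coordinates `(x,
    -- Y)`. It is large because `v Λ = v Y / v d`.
    set Λ := (y' - W.negY x' y' + Y) / d with hΛ
    have hΛs : Λ = 2 * s + W.a₁ := by
      rw [hΛ, hs, hYd, negY, negY]
      field_simp
      rw [hd]
      ring
    have hYΛ : v Y = v Λ * v d := by
      rw [hΛ, map_div₀, hY]
      have := v.ne_zero_iff.mpr hxx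
      field_simp
    have hadd : 4 * W.addX x' x s = Λ ^ 2 - (W.b₂ + 4 * x + 4 * x') := by
      rw [addX, hΛs, b₂]; ring
    have hYsq : v Y ^ 2 = v (x - e₁) * v (x - e₂) * v (x - e₃) := by
      rw [← map_pow, hsq h, map_mul, h4, one_mul, map_mul, map_mul]
    -- From `v Y ^ 2 = v Λ ^ 2 * v d ^ 2` and `v d` smaller than each factor of `v Y ^ 2`, it
    -- follows that `v Λ ^ 2` exceeds each factor `v (x - e)`.
    have bound {a b c : Γ} (ha : v d < a) (hb : v d < b) (hc : v d < c)
        (h : v Y ^ 2 = a * b * c) : c < v Λ ^ 2 := by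
      rw [hYΛ, mul_pow, sq (v d), mul_comm (v Λ ^ 2)] at h
      by_contra! hle
      have hab : v d * v d < a * b := mul_lt_mul'' ha hb zero_le zero_le
      have : v d * v d * v Λ ^ 2 < a * b * c :=
        (mul_le_mul_right hle _).trans_lt (mul_lt_mul_of_pos_right hab (zero_le.trans_lt hc))
      exact this.ne h
    have c₁ := bound hx₂ hx₃ hx₁ (hYsq.trans (mul_rotate _ _ _))
    have c₂ := bound hx₁ hx₃ hx₂ (hYsq.trans (mul_right_comm _ _ _))
    -- Since `e₁ - e₂` is a unit, `x - e₁` and `x - e₂` cannot both have value below one.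
    have hΛ1 : 1 < v Λ ^ 2 := by
      rw [← he, show e₁ - e₂ = (x - e₂) - (x - e₁) by ring]
      exact v.map_sub_lt c₂ c₁
    have hxΛ : v x < v Λ ^ 2 := by
      rw [show x = (x - e₁) + e₁ by ring]
      exact v.map_add_lt c₁ (he₁.trans_lt hΛ1)
    have hxΛ' : v x' < v Λ ^ 2 := by
      rw [show x' = d + x by ring]
      exact v.map_add_lt (hx₁.trans c₁) hxΛ
    have hb : v W.b₂ ≤ 1 := by
      rw [WeierstrassCurve.b₂]
      exact v.map_add_le (by simpa using pow_le_one' hW.a₁ 2)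
        (v.map_mul_le_of_le_one h4.le hW.a₂)
    have hval : v (4 * W.addX x' x s) = v Λ ^ 2 := by
      rw [hadd, v.map_sub_eq_of_lt_left, map_pow]
      rw [map_pow]
      exact v.map_add_lt (v.map_add_lt (hb.trans_lt hΛ1) (v.map_mul_lt_of_le_one h4.le hxΛ))
        (v.map_mul_lt_of_le_one h4.le hxΛ')
    rw [map_mul, h4, one_mul] at hval
    rwa [hval]

end Point

end WeierstrassCurve.Affine

/-! ### Reduction at 2 and odd torsion over quadratic fields. -/

theorem Valuation.map_lt_one_of_map_mul_lt_one {F Γ : Type*} [Field F]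
    [LinearOrderedCommGroupWithZero Γ] (v : Valuation F Γ) {a b : F} (h : v (a * b) < 1) :
    v a < 1 ∨ v b < 1 := by
  by_contra! hc
  rw [map_mul] at h
  exact absurd (one_le_mul hc.1 hc.2) h.not_ge

/-- Integral elements of a quadratic field reduce into the field with four elements at a place
above `2`. -/
theorem Valuation.residue_of_finrank_eq_two {K Γ : Type*} [Field K] [CharZero K]
    [LinearOrderedCommGroupWithZero Γ] (v : Valuation K Γ) (hv : v (2 : K) < 1)
    (hK : Module.finrank ℚ K = 2) {x : K} (hx : v x ≤ 1) :
    v x < 1 ∨ v (x - 1) < 1 ∨ v (x ^ 2 + x + 1) < 1 := by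
  have : FiniteDimensional ℚ K := Module.finite_of_finrank_eq_succ hK
  -- An integral relation divided by its content stays nonzero modulo 2, so the residue of `x` is a
  -- root of a nonzero polynomial of degree at most two over the field with two elements.
  have hdep : ¬ LinearIndependent ℤ ![1, x, x ^ 2] := by
    rw [LinearIndependent.iff_fractionRing ℤ ℚ]
    intro h
    simpa [hK] using h.fintype_card_le_finrank
  obtain ⟨g, hg, i₀, hi₀⟩ := Fintype.not_linearIndependent_iff.mp hdep
  obtain ⟨f, hf, hf1⟩ := Finset.extract_gcd g (Finset.univ_nonempty (α := Fin 3))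
  have hd : Finset.univ.gcd g ≠ 0 := fun h => hi₀ (Finset.gcd_eq_zero_iff.mp h i₀ (Finset.mem_univ _))
  have hrel : (f 0 : K) + f 1 * x + f 2 * x ^ 2 = 0 := by
    have h0 : ((Finset.univ.gcd g : ℤ) : K) ≠ 0 := Int.cast_ne_zero.mpr hd
    refine mul_left_cancel₀ h0 ?_
    simp only [Fin.sum_univ_three, zsmul_eq_mul, Matrix.cons_val] at hg
    rw [hf 0 (Finset.mem_univ _), hf 1 (Finset.mem_univ _), hf 2 (Finset.mem_univ _)] at hg
    push_cast at hg
    linear_combination hg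
  have hodd : ¬ (2 ∣ f 0 ∧ 2 ∣ f 1 ∧ 2 ∣ f 2) := by
    rintro ⟨h0, h1, h2⟩
    have : (2 : ℤ) ∣ Finset.univ.gcd f := Finset.dvd_gcd fun i _ => by
      fin_cases i <;> assumption
    rw [hf1] at this
    norm_num at this
  have key : v (((f 0 % 2 : ℤ) : K) + (f 1 % 2 : ℤ) * x + (f 2 % 2 : ℤ) * x ^ 2) < 1 := by
    have e (i) : (f i : K) = 2 * ((f i / 2 : ℤ) : K) + (f i % 2 : ℤ) := by
      exact_mod_cast (Int.mul_ediv_add_emod (f i) 2).symm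
    have : ((f 0 % 2 : ℤ) : K) + (f 1 % 2 : ℤ) * x + (f 2 % 2 : ℤ) * x ^ 2 =
        -(((f 0 / 2 : ℤ) : K) + (f 1 / 2 : ℤ) * x + (f 2 / 2 : ℤ) * x ^ 2) * 2 := by
      linear_combination hrel - e 0 - e 1 * x - e 2 * x ^ 2
    rw [this]
    refine v.map_mul_lt_of_le_one ?_ hv
    rw [v.map_neg]
    exact v.map_add_le (v.map_add_le (v.map_intCast_le_one _)
      (v.map_mul_le_of_le_one (v.map_intCast_le_one _) hx))
      (v.map_mul_le_of_le_one (v.map_intCast_le_one _) (by simpa using pow_le_one' hx 2))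
  have hsq {y : K} (h : v (y ^ 2) < 1) : v y < 1 :=
    (v.map_lt_one_of_map_mul_lt_one (sq y ▸ h)).elim id id
  rcases Int.emod_two_eq_zero_or_one (f 0) with h0 | h0 <;>
  rcases Int.emod_two_eq_zero_or_one (f 1) with h1 | h1 <;>
  rcases Int.emod_two_eq_zero_or_one (f 2) with h2 | h2 <;>
  simp only [h0, h1, h2, Int.cast_zero, Int.cast_one, zero_mul, one_mul, zero_add, add_zero] at key
  · exact absurd ⟨Int.dvd_of_emod_eq_zero h0, Int.dvd_of_emod_eq_zero h1,
      Int.dvd_of_emod_eq_zero h2⟩ hodd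
  · exact Or.inl (hsq key)
  · exact Or.inl key
  · rw [show x + x ^ 2 = x * (x + 1) by ring] at key
    refine (v.map_lt_one_of_map_mul_lt_one key).imp_right fun h => Or.inl ?_
    rw [show x - 1 = (x + 1) - 2 by ring]
    exact v.map_sub_lt h hv
  · simp at key
  · refine Or.inr (Or.inl (hsq ?_))
    rw [show (x - 1) ^ 2 = (1 + x ^ 2) - x * 2 by ring]
    exact v.map_sub_lt key (v.map_mul_lt_of_le_one hx hv)
  · refine Or.inr (Or.inl ?_)
    rw [show x - 1 = (1 + x) - 2 by ring]
    exact v.map_sub_lt key hv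
  · refine Or.inr (Or.inr ?_)
    rwa [show x ^ 2 + x + 1 = 1 + x + x ^ 2 by ring]

namespace WeierstrassCurve.Affine

variable {F Γ : Type*} [Field F] [LinearOrderedCommGroupWithZero Γ] {v : Valuation F Γ}
  {W : WeierstrassCurve.Affine F} [DecidableEq F]

/-- The duplication formula for the `x`-coordinate. -/
theorem Point.exists_two_nsmul_some {x y : F} (h : W.Nonsingular x y)
    (h2 : 2 • (some x y h : W.Point) ≠ 0) :
    ∃ (x' y' : F) (h' : W.Nonsingular x' y'), 2 • (some x y h : W.Point) = some x' y' h' ∧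
      x' * (4 * x ^ 3 + W.b₂ * x ^ 2 + 2 * W.b₄ * x + W.b₆) =
        x ^ 4 - W.b₄ * x ^ 2 - 2 * W.b₆ * x - W.b₈ := by
  have hy : y ≠ W.negY x y := fun hy => h2 (by rw [two_nsmul, add_self_of_Y_eq hy])
  refine ⟨_, _, _, by rw [two_nsmul, add_self_of_Y_ne hy], ?_⟩
  have e := (equation_iff _ _).mp h.1
  have hδ : 2 * y + W.a₁ * x + W.a₃ ≠ 0 := by
    intro h0
    exact hy (by rw [negY]; linear_combination h0)
  have hd : 4 * x ^ 3 + W.b₂ * x ^ 2 + 2 * W.b₄ * x + W.b₆ = (2 * y + W.a₁ * x + W.a₃) ^ 2 := by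
    rw [b₂, b₄, b₆]
    linear_combination (-4) * e
  have hs : W.slope x x y y * (2 * y + W.a₁ * x + W.a₃) =
      3 * x ^ 2 + 2 * W.a₂ * x + W.a₄ - W.a₁ * y := by
    rw [slope_of_Y_ne rfl hy, show y - W.negY x y = 2 * y + W.a₁ * x + W.a₃ by rw [negY]; ring,
      div_mul_cancel₀ _ hδ]
  rw [hd, addX, b₄, b₆, b₈]
  generalize W.slope x x y y = s at hs
  linear_combination (s * (2 * y + W.a₁ * x + W.a₃) + (3 * x ^ 2 + 2 * W.a₂ * x + W.a₄ - W.a₁ * y) +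
    W.a₁ * (2 * y + W.a₁ * x + W.a₃)) * hs - (W.a₁ ^ 2 + 4 * W.a₂ + 8 * x) * e

/-- A curve over a quadratic field whose `b`-invariants are odd at a place above `2` has no points
of odd order. -/
theorem Point.eq_zero_of_odd_nsmul_eq_zero [CharZero F] (hF : Module.finrank ℚ F = 2)
    (hv : v (2 : F) < 1) (hW : IsIntegralAt v W) (h₂ : v (W.b₂ - 1) < 1) (h₄ : v (W.b₄ - 1) < 1)
    (h₆ : v (W.b₆ - 1) < 1) (h₈ : v (W.b₈ - 1) < 1) {n : ℕ} (hn : Odd n) {P : W.Point}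
    (hP : n • P = 0) : P = 0 := by
  by_contra hP0
  have hvn : v (n : F) = 1 := by
    have := v.map_intCast_eq_one_of_isCoprime (m := 2) (n := n) (by simpa using hv)
      (Nat.isCoprime_iff_coprime.mpr (Nat.coprime_two_left.mpr hn))
    simpa using this
  have hint {x y : F} {h : W.Nonsingular x y} (hP : n • (some x y h : W.Point) = 0) : v x ≤ 1 := by
    by_contra! hx
    exact some_ne_zero h (eq_zero_of_inKernel_of_nsmul_eq_zero hW (P := some x y h) hx hvn hP)
  -- With all `b`-invariants equal to 1 modulo the place, duplication becomes `x' (x - 1)² = x⁴ + x²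
  -- + 1`.
  have hstep {x y : F} (h : W.Nonsingular x y) (hP : n • (some x y h : W.Point) = 0) :
      ∃ (x' y' : F) (h' : W.Nonsingular x' y'), n • (some x' y' h' : W.Point) = 0 ∧
        v (x' * (x - 1) ^ 2 - (x ^ 4 + x ^ 2 + 1)) < 1 := by
    have h2 : 2 • (some x y h : W.Point) ≠ 0 := by
      intro h2
      obtain ⟨k, rfl⟩ := hn
      rw [add_smul, mul_comm, mul_smul, h2, smul_zero, one_smul, zero_add] at hP
      exact some_ne_zero h hP
    obtain ⟨x', y', h', h2P, hx'⟩ := exists_two_nsmul_some h h2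
    have hP' : n • (some x' y' h' : W.Point) = 0 := by
      rw [← h2P, smul_comm, hP, smul_zero]
    refine ⟨x', y', h', hP', ?_⟩
    have ix := hint hP
    have ix' := hint hP'
    have ix2 : v (x ^ 2) ≤ 1 := by simpa using pow_le_one' ix 2
    have ix3 : v (x ^ 3) ≤ 1 := by simpa using pow_le_one' ix 3
    have ib₄ : v W.b₄ ≤ 1 := by
      rw [show W.b₄ = (W.b₄ - 1) + 1 by ring]
      exact v.map_add_le h₄.le v.map_one.le
    have ib₆ : v W.b₆ ≤ 1 := by
      rw [show W.b₆ = (W.b₆ - 1) + 1 by ring]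
      exact v.map_add_le h₆.le v.map_one.le
    rw [show x' * (x - 1) ^ 2 - (x ^ 4 + x ^ 2 + 1) =
      -(x' * (2 * x ^ 3 + x + W.b₄ * x) + W.b₆ * x + x ^ 2 + 1) * 2
      - (x' * x ^ 2) * (W.b₂ - 1) - (x ^ 2) * (W.b₄ - 1) - x' * (W.b₆ - 1) - (W.b₈ - 1) by
        linear_combination hx']
    refine v.map_sub_lt (v.map_sub_lt (v.map_sub_lt (v.map_sub_lt ?_ ?_) ?_) ?_) h₈
    · refine v.map_mul_lt_of_le_one ?_ hv
      rw [v.map_neg]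
      refine v.map_add_le (v.map_add_le (v.map_add_le ?_ ?_) ix2) v.map_one.le
      · exact v.map_mul_le_of_le_one ix' (v.map_add_le (v.map_add_le
          (v.map_mul_le_of_le_one hv.le ix3) ix) (v.map_mul_le_of_le_one ib₄ ix))
      · exact v.map_mul_le_of_le_one ib₆ ix
    · exact v.map_mul_lt_of_le_one (v.map_mul_le_of_le_one ix' ix2) h₂
    · exact v.map_mul_lt_of_le_one ix2 h₄
    · exact v.map_mul_lt_of_le_one ix' h₆
  have contra {z : F} (h1 : v z < 1) (h2 : v (1 - z) < 1) : False := by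
    have := v.map_add_lt h1 h2
    simp at this
  have not_one {x y : F} (h : W.Nonsingular x y) (hP : n • (some x y h : W.Point) = 0) :
      ¬ v (x - 1) < 1 := by
    intro hx
    obtain ⟨x', y', h', hP', hlt⟩ := hstep h hP
    have ix := hint hP
    have ix' := hint hP'
    -- Dividing the error term of `hstep` by `x - 1` leaves remainder `-3`; thus `z - 1` is that
    -- error, while `z` is small because `x - 1` and 2 are.
    refine contra (z := (x' * (x - 1) - (x ^ 3 + x ^ 2 + 2 * x + 2)) * (x - 1) - 2) ?_ ?_
    · refine v.map_sub_lt (v.map_mul_lt_of_le_one (v.map_sub_le (v.map_mul_le_of_le_one ix' hx.le)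
        ?_) hx) hv
      exact v.map_add_le (v.map_add_le (v.map_add_le (by simpa using pow_le_one' ix 3)
        (by simpa using pow_le_one' ix 2)) (v.map_mul_le_of_le_one hv.le ix)) hv.le
    · rw [← v.map_neg]
      convert hlt using 2
      ring
  have not_zero {x y : F} (h : W.Nonsingular x y) (hP : n • (some x y h : W.Point) = 0) :
      ¬ v x < 1 := by
    intro hx
    obtain ⟨x', y', h', hP', hlt⟩ := hstep h hP
    have ix' := hint hP'
    refine not_one h' hP' ?_
    rw [show x' - 1 = (x' * (x - 1) ^ 2 - (x ^ 4 + x ^ 2 + 1)) + (x' * (2 - x) + x ^ 3 + x) * x by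
      ring]
    refine v.map_add_lt hlt (v.map_mul_lt_of_le_one ?_ hx)
    exact v.map_add_le (v.map_add_le (v.map_mul_le_of_le_one ix' (v.map_sub_le hv.le hx.le))
      (by simpa using pow_le_one' hx.le 3)) hx.le
  rcases P with _ | ⟨x, y, h⟩
  · exact hP0 rfl
  rcases v.residue_of_finrank_eq_two hv hF (hint hP) with hx | hx | hx
  · exact not_zero h hP hx
  · exact not_one h hP hx
  -- Here `x² + x + 1` divides `x⁴ + x² + 1`, so either the doubled point has residue 0 or `x` has
  -- residue 1.
  · obtain ⟨x', y', h', hP', hlt⟩ := hstep h hP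
    have ix := hint hP
    have h3 : v (x' * (x - 1) ^ 2) < 1 := by
      rw [show x' * (x - 1) ^ 2 = (x' * (x - 1) ^ 2 - (x ^ 4 + x ^ 2 + 1)) +
        (x ^ 2 - x + 1) * (x ^ 2 + x + 1) by ring]
      refine v.map_add_lt hlt (v.map_mul_lt_of_le_one ?_ hx)
      exact v.map_add_le (v.map_sub_le (by simpa using pow_le_one' ix 2) ix) v.map_one.le
    rcases v.map_lt_one_of_map_mul_lt_one h3 with h4 | h4
    · exact not_zero h' hP' h4
    · rw [sq] at h4
      exact not_one h hP ((v.map_lt_one_of_map_mul_lt_one h4).elim id id)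

end WeierstrassCurve.Affine

/-! ### Total ramification and automorphisms of cyclotomic fields. -/

namespace Valuation

variable {F Γ : Type*} [Field F] [LinearOrderedCommGroupWithZero Γ] (v : Valuation F Γ)

theorem map_eq_one_of_pow_eq_one {x : F} {n : ℕ} (hn : n ≠ 0) (h : x ^ n = 1) : v x = 1 := by
  have : v x ^ n = 1 := by rw [← map_pow, h, map_one]
  exact (pow_eq_one_iff_of_nonneg zero_le hn).mp this

theorem map_pow_sub_one_le {x : F} (h : v x ≤ 1) (n : ℕ) : v (x ^ n - 1) ≤ v (x - 1) := by
  rw [← geom_sum_mul]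
  exact v.map_mul_le_of_le_one (v.map_sum_le fun i _ => by simpa using pow_le_one' h i) le_rfl

/-- Each of the two roots is a power of the other, and `x - 1` divides `x ^ i - 1` integrally. -/
theorem map_sub_one_of_isPrimitiveRoot {x y : F} {n : ℕ} (hn : n ≠ 0) (hx : IsPrimitiveRoot x n)
    (hy : IsPrimitiveRoot y n) : v (y - 1) = v (x - 1) := by
  have : NeZero n := ⟨hn⟩
  have aux {x y : F} (hx : IsPrimitiveRoot x n) (hy : IsPrimitiveRoot y n) :
      v (y - 1) ≤ v (x - 1) := by
    obtain ⟨i, -, rfl⟩ := hx.eq_pow_of_pow_eq_one hy.pow_eq_one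
    exact v.map_pow_sub_one_le (v.map_eq_one_of_pow_eq_one hn hx.pow_eq_one).le i
  exact (aux hx hy).antisymm (aux hy hx)

/-- The value of `ζ - 1` for a primitive root of unity `ζ` of prime power order. -/
theorem map_sub_one_pow_totient {p n : ℕ} [Fact p.Prime] {ζ : F}
    (hζ : IsPrimitiveRoot ζ (p ^ (n + 1))) :
    v (ζ - 1) ^ (p ^ (n + 1)).totient = v (p : F) := by
  have hp := (Fact.out : p.Prime)
  have hn : p ^ (n + 1) ≠ 0 := pow_ne_zero _ hp.ne_zero
  -- The cyclotomic polynomial takes the value `p` at 1, so `p` is the product of the `1 - μ`, all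
  -- of equal value.
  have h1 := Polynomial.eval_one_cyclotomic_prime_pow (R := F) (p := p) n
  rw [Polynomial.cyclotomic_eq_prod_X_sub_primitiveRoots hζ, Polynomial.eval_prod] at h1
  rw [← h1, map_prod, ← hζ.card_primitiveRoots, ← Finset.prod_const]
  refine Finset.prod_congr rfl fun μ hμ => ?_
  have hμ := (mem_primitiveRoots (Nat.pos_of_ne_zero hn)).mp hμ
  simp only [Polynomial.eval_sub, Polynomial.eval_X, Polynomial.eval_C]
  rw [v.map_sub_swap 1 μ, v.map_sub_one_of_isPrimitiveRoot hn hζ hμ]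

/-- Let `ϖ` be a root of a polynomial relation of degree `d` with `v ϖ ^ d = v p`, where the
values of the coefficient field are powers of `v p`. Polynomials of degree less than `d` are
almost unchanged when `ϖ` is multiplied by an element congruent to one. -/
theorem map_aeval_sub_aeval_lt {K : Type*} [Field K] [Algebra K F] {q ϖ ϖ' : F} {d : ℕ}
    (hq : v q < 1) (hK : ∀ c : K, c ≠ 0 → ∃ k : ℤ, v (algebraMap K F c) = v q ^ k)
    (hϖ : v ϖ ^ d = v q) (h : v (ϖ' - ϖ) < v ϖ) {f : Polynomial K} (hf : f ≠ 0)
    (hfd : f.natDegree < d) :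
    v (Polynomial.aeval ϖ' f - Polynomial.aeval ϖ f) < v (Polynomial.aeval ϖ f) := by
  have hϖ0 : v ϖ ≠ 0 := (zero_le.trans_lt h).ne'
  have hϖ1 : v ϖ < 1 := by
    by_contra! hc
    exact absurd (hϖ ▸ one_le_pow_of_one_le' hc d) hq.not_ge
  have hv' : v ϖ' = v ϖ := v.map_eq_of_sub_lt h
  have hzpow {a b : ℤ} (hab : v ϖ ^ a = v ϖ ^ b) : a = b :=
    (zpow_right_strictAnti₀ (zero_lt_iff.mpr hϖ0) hϖ1).injective hab
  set T : ℕ → F := fun i => algebraMap K F (f.coeff i) * ϖ ^ i with hT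
  set T' : ℕ → F := fun i => algebraMap K F (f.coeff i) * ϖ' ^ i with hT'
  have hTT (i : ℕ) : v (T' i) = v (T i) := by simp only [hT, hT', map_mul, map_pow, hv']
  have hval (i : ℕ) (hi : i ∈ f.support) : ∃ k : ℤ, v (T i) = v ϖ ^ (d * k + i) := by
    obtain ⟨k, hk⟩ := hK _ (Polynomial.mem_support_iff.mp hi)
    refine ⟨k, ?_⟩
    simp only [hT, map_mul, map_pow, hk, ← hϖ]
    rw [zpow_add₀ hϖ0, zpow_mul, zpow_natCast, zpow_natCast]
  -- The exponents `d k + i` with `i < d` are distinct modulo `d`, so no two terms have the same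
  -- value and a single term dominates.
  have hinj {i j : ℕ} (hi : i ∈ f.support) (hj : j ∈ f.support) (hij : v (T i) = v (T j)) :
      i = j := by
    obtain ⟨k, hk⟩ := hval i hi
    obtain ⟨m, hm⟩ := hval j hj
    have h1 := hzpow (hk.symm.trans (hij.trans hm))
    have hid : i < d := (Polynomial.le_natDegree_of_mem_supp i hi).trans_lt hfd
    have hjd : j < d := (Polynomial.le_natDegree_of_mem_supp j hj).trans_lt hfd
    have h2 : ((d * k + i) % d : ℤ) = (d * m + j) % d := by rw [h1]
    rw [Int.mul_add_emod_self_left, Int.mul_add_emod_self_left] at h2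
    exact_mod_cast (show (i : ℤ) = j by
      rwa [Int.emod_eq_of_lt (by omega) (by omega), Int.emod_eq_of_lt (by omega) (by omega)] at h2)
  obtain ⟨j, hj, hmax⟩ := f.support.exists_max_image (fun i => v (T i))
    (Polynomial.support_nonempty.mpr hf)
  have hlt (i : ℕ) (hi : i ∈ f.support) (hij : i ≠ j) : v (T i) < v (T j) :=
    lt_of_le_of_ne (hmax i hi) fun h => hij (hinj hi hj h)
  have hTj : v (T j) ≠ 0 := by
    obtain ⟨k, hk⟩ := hval j hj
    rw [hk]
    exact zpow_ne_zero _ hϖ0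
  have hs : Polynomial.aeval ϖ f = ∑ i ∈ f.support, T i := by
    rw [Polynomial.aeval_def, Polynomial.eval₂_eq_sum, Polynomial.sum]
  have hs' : Polynomial.aeval ϖ' f = ∑ i ∈ f.support, T' i := by
    rw [Polynomial.aeval_def, Polynomial.eval₂_eq_sum, Polynomial.sum]
  have hvf : v (Polynomial.aeval ϖ f) = v (T j) := by
    rw [hs]
    refine v.map_sum_eq_of_lt hj fun i hi => ?_
    simp only [Finset.mem_sdiff, Finset.mem_singleton] at hi
    exact hlt i hi.1 hi.2
  rw [hvf, hs, hs', ← Finset.sum_sub_distrib]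
  refine v.map_sum_lt hTj fun i hi => ?_
  by_cases hij : i = j
  · subst hij
    have hϖ0' : ϖ ≠ 0 := v.ne_zero_iff.mp hϖ0
    have h1 : v (ϖ' / ϖ - 1) < 1 := by
      rw [div_sub_one hϖ0', map_div₀]
      exact (div_lt_one₀ (zero_lt_iff.mpr hϖ0)).mpr h
    have h2 : v (ϖ' / ϖ) ≤ 1 := by
      rw [map_div₀, hv', div_self hϖ0]
    have h3 : T' i - T i = ((ϖ' / ϖ) ^ i - 1) * T i := by
      simp only [hT, hT', div_pow]
      field_simp
    rw [h3, map_mul]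
    exact mul_lt_of_lt_one_left (zero_lt_iff.mpr hTj) ((v.map_pow_sub_one_le h2 i).trans_lt h1)
  · exact v.map_sub_lt ((hTT i).trans_lt (hlt i hi hij)) (hlt i hi hij)

/-- An automorphism raising roots of unity of `p`-power order to a power congruent to one modulo
`p` acts trivially on the values modulo higher values. -/
theorem map_apply_sub_lt_of_mem_adjoin {K : Type*} [Field K] [CharZero K] [Algebra K F] {p n a : ℕ}
    [Fact p.Prime] (hp1 : v (p : F) < 1)
    (hK : ∀ c : K, c ≠ 0 → ∃ k : ℤ, v (algebraMap K F c) = v (p : F) ^ k) {ζ : F}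
    (hζ : IsPrimitiveRoot ζ (p ^ (n + 1))) (σ : F ≃ₐ[K] F) (ha : a ≡ 1 [MOD p])
    (hσ : σ ζ = ζ ^ a) {w : F} (hw : w ∈ IntermediateField.adjoin K {ζ}) (hw0 : w ≠ 0) :
    v (σ w - w) < v w := by
  have hp := (Fact.out : p.Prime)
  have : CharZero F := charZero_of_injective_algebraMap (algebraMap K F).injective
  have hn : p ^ (n + 1) ≠ 0 := pow_ne_zero _ hp.ne_zero
  have hζ1 : v ζ = 1 := v.map_eq_one_of_pow_eq_one hn hζ.pow_eq_one
  have hϖ := v.map_sub_one_pow_totient hζ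
  have hϖ0 : ζ - 1 ≠ 0 :=
    sub_ne_zero.mpr (hζ.ne_one (Nat.one_lt_pow (by omega) hp.one_lt))
  have hϖ1 : v (ζ - 1) < 1 := by
    by_contra! hc
    exact absurd (hϖ ▸ one_le_pow_of_one_le' hc _) hp1.not_ge
  have hint : IsIntegral K ζ := (hζ.isIntegral (Nat.pos_of_ne_zero hn)).tower_top
  rw [← IntermediateField.mem_toSubalgebra,
    IntermediateField.adjoin_simple_toSubalgebra_of_isAlgebraic hint.isAlgebraic,
    Algebra.adjoin_singleton_eq_range_aeval] at hw
  obtain ⟨g, rfl⟩ := hw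
  have hmonic := Polynomial.cyclotomic.monic (p ^ (n + 1)) K
  -- Reducing modulo the cyclotomic polynomial brings the degree below the totient; the remainder is
  -- then re-expanded in powers of `ζ - 1`.
  set f := (g %ₘ Polynomial.cyclotomic (p ^ (n + 1)) K).comp (Polynomial.X + 1) with hf
  have hroot : Polynomial.aeval ζ (Polynomial.cyclotomic (p ^ (n + 1)) K) = 0 := by
    rw [← Polynomial.eval_map_algebraMap, Polynomial.map_cyclotomic]
    exact hζ.isRoot_cyclotomic (Nat.pos_of_ne_zero hn)
  have hgf : Polynomial.aeval ζ g = Polynomial.aeval (ζ - 1) f := by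
    rw [hf, Polynomial.aeval_comp]
    simp only [map_add, Polynomial.aeval_X, map_one, sub_add_cancel]
    rw [Polynomial.aeval_modByMonic_eq_self_of_root hroot]
  change v (σ (Polynomial.aeval ζ g) - Polynomial.aeval ζ g) < v (Polynomial.aeval ζ g)
  have hw0' : Polynomial.aeval ζ g ≠ 0 := hw0
  rw [hgf] at hw0' ⊢
  have hσf : σ (Polynomial.aeval (ζ - 1) f) = Polynomial.aeval (σ (ζ - 1)) f :=
    (Polynomial.aeval_algHom_apply σ.toAlgHom (ζ - 1) f).symm
  rw [hσf]
  refine v.map_aeval_sub_aeval_lt hp1 hK hϖ ?_ ?_ ?_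
  · rw [_root_.map_sub σ, map_one, hσ, ← geom_sum_mul,
      show (∑ i ∈ Finset.range a, ζ ^ i) * (ζ - 1) - (ζ - 1) =
        ((∑ i ∈ Finset.range a, (ζ ^ i - 1)) + (a - 1)) * (ζ - 1) by
          rw [Finset.sum_sub_distrib]; simp; ring, map_mul]
    refine mul_lt_of_lt_one_left (v.pos_iff.mpr hϖ0) (v.map_add_lt ?_ ?_)
    · exact v.map_sum_lt one_ne_zero fun i _ => (v.map_pow_sub_one_le hζ1.le i).trans_lt hϖ1
    · obtain ⟨k, hk⟩ := (Nat.modEq_iff_dvd.mp ha.symm)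
      have : (a : F) - 1 = k * p := by
        rw [mul_comm]
        exact_mod_cast congrArg (Int.cast (R := F)) hk
      rw [this]
      exact v.map_mul_lt_of_le_one (v.map_intCast_le_one k) hp1
  · intro h0
    exact hw0' (by rw [h0, map_zero])
  · rw [hf, Polynomial.natDegree_comp, show (Polynomial.X + 1 : Polynomial K).natDegree = 1 from
      Polynomial.natDegree_X_add_C 1, mul_one]
    refine (Polynomial.natDegree_modByMonic_lt _ hmonic fun h1 => ?_).trans_eq
      (Polynomial.natDegree_cyclotomic _ _)
    have := Polynomial.natDegree_cyclotomic (p ^ (n + 1)) K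
    rw [h1, Polynomial.natDegree_one] at this
    exact (Nat.totient_pos.mpr (Nat.pos_of_ne_zero hn)).ne this

end Valuation

/-! ### Places above a prime that splits completely. -/

open scoped NumberField

/-- Above a prime that splits completely there is a place at which it is a uniformizer. -/
theorem EllCurve.SplitsCompletely.exists_valuation_eq {K : Type*} [Field K] [NumberField K] {p : ℕ}
    [Fact p.Prime] (h : EllCurve.SplitsCompletely p K) :
    ∃ P : IsDedekindDomain.HeightOneSpectrum (𝓞 K),
      P.valuation K (p : K) = WithZero.exp (-1 : ℤ) := by
  have hp := (Fact.out : p.Prime)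
  set I : Ideal ℤ := Ideal.span {(p : ℤ)} with hI
  have hmax : I.IsMaximal :=
    PrincipalIdealRing.isMaximal_of_irreducible (Nat.prime_iff_prime_int.mp hp).irreducible
  have hcard : (I.primesOver (𝓞 K)).ncard = Module.finrank ℤ (𝓞 K) :=
    Eq.trans h (NumberField.RingOfIntegers.rank K).symm
  have hfin : (I.primesOver (𝓞 K)).Finite :=
    Set.finite_of_ncard_ne_zero (by rw [hcard]; exact Module.finrank_pos.ne')
  have : Fintype (I.primesOver (𝓞 K)) := hfin.fintype
  have hsum := Ideal.sum_ramification_inertia_eq_finrank I (𝓞 K)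
  obtain ⟨Q, hQ⟩ : (I.primesOver (𝓞 K)).Nonempty :=
    Set.nonempty_of_ncard_ne_zero (by rw [hcard]; exact Module.finrank_pos.ne')
  have hpos (q : I.primesOver (𝓞 K)) : 1 ≤ q.1.ramificationIdx ℤ * q.1.inertiaDeg ℤ := by
    have := q.2.1
    exact Nat.mul_pos (Ideal.ramificationIdx_pos _ _) (Ideal.inertiaDeg_pos _ _)
  -- The products `e f` sum to the degree, which is the number of primes, so each equals 1.
  have hone : Q.ramificationIdx ℤ * Q.inertiaDeg ℤ = 1 := by
    have h1 : ∑ q : I.primesOver (𝓞 K), 1 =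
        ∑ q : I.primesOver (𝓞 K), q.1.ramificationIdx ℤ * q.1.inertiaDeg ℤ := by
      rw [hsum, ← hcard, Set.ncard_eq_toFinset_card']
      simp
    exact ((Finset.sum_eq_sum_iff_of_le fun q _ => hpos q).mp h1 ⟨Q, hQ⟩ (Finset.mem_univ _)).symm
  have hQp : Q.IsPrime := hQ.1
  have hQo : Q.LiesOver I := hQ.2
  have hmap : I.map (algebraMap ℤ (𝓞 K)) = Ideal.span {(p : 𝓞 K)} := by
    rw [hI, Ideal.map_span, Set.image_singleton]
    simp
  have hp0 : (p : 𝓞 K) ≠ 0 := Nat.cast_ne_zero.mpr hp.ne_zero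
  have hmap0 : I.map (algebraMap ℤ (𝓞 K)) ≠ ⊥ := by
    rw [hmap]
    simpa using hp0
  refine ⟨⟨Q, hQp, ne_bot_of_le_ne_bot hmap0 (Ideal.map_le_of_le_comap (Q.over_def I).le)⟩, ?_⟩
  rw [show (p : K) = algebraMap (𝓞 K) K (p : 𝓞 K) by simp,
    IsDedekindDomain.HeightOneSpectrum.valuation_of_algebraMap,
    IsDedekindDomain.HeightOneSpectrum.intValuation_eq_exp_neg_multiplicity _ hp0, ← hmap,
    ← Ideal.IsDedekindDomain.ramificationIdx_eq_multiplicity I Q hmap0, Nat.eq_one_of_mul_eq_one_right hone]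
  rfl

/-- A valuation can be extended to a larger field. -/
theorem Valuation.exists_valuationSubring_extension {K Ω Γ : Type*} [Field K] [Field Ω]
    [LinearOrderedCommGroupWithZero Γ] (v : Valuation K Γ) (f : K →+* Ω) :
    ∃ B : ValuationSubring Ω, (∀ x, v x = 1 → B.valuation (f x) = 1) ∧
      ∀ x, v x < 1 → B.valuation (f x) < 1 := by
  -- A valuation ring dominating the image of the valuation ring of `v`; locality of the map keeps
  -- nonunits nonunits.
  obtain ⟨B, hB, hloc⟩ :=
    IsLocalRing.exists_factor_valuationRing (f.comp v.valuationSubring.subtype)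
  have hle {x : K} (hx : v x ≤ 1) : B.valuation (f x) ≤ 1 :=
    (B.valuation_le_one_iff _).mpr (hB ⟨x, hx⟩)
  refine ⟨B, fun x hx => (hle hx.le).antisymm ?_, fun x hx => (hle hx.le).lt_of_ne fun h1 => ?_⟩
  · have h1 := hle (x := x⁻¹) (by rw [map_inv₀, hx, inv_one])
    have hx0 : x ≠ 0 := by rintro rfl; simp at hx
    rw [map_inv₀, map_inv₀] at h1
    exact (inv_le_one₀ (B.valuation.pos_iff.mpr ((map_ne_zero f).mpr hx0))).mp h1
  · have hu : IsUnit ((f.comp v.valuationSubring.subtype).codRestrict B.toSubring hB ⟨x, hx.le⟩) :=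
      (B.valuation_eq_one_iff _).mpr h1
    obtain ⟨y, hy⟩ := isUnit_iff_exists_inv.mp (hloc.map_nonunit _ hu)
    have hxy : v x * v y = 1 := by
      rw [← map_mul, show x * y = 1 from congrArg Subtype.val hy, map_one]
    exact absurd (hxy ▸ (mul_le_of_le_one_right' y.2)) hx.not_ge

/-- Over a field in which `p` splits completely there is a place `v` of the algebraic closure above
`p` such that the values on the base field are powers of `v p`. -/
theorem EllCurve.SplitsCompletely.exists_valuationSubring {K : Type*} [Field K] [NumberField K]
    {p : ℕ} [Fact p.Prime] (h : EllCurve.SplitsCompletely p K) :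
    ∃ B : ValuationSubring (AlgebraicClosure K), B.valuation (p : AlgebraicClosure K) < 1 ∧
      ∀ c : K, c ≠ 0 → ∃ k : ℤ, B.valuation (algebraMap K (AlgebraicClosure K) c) =
        B.valuation (p : AlgebraicClosure K) ^ k := by
  obtain ⟨P, hP⟩ := h.exists_valuation_eq
  obtain ⟨B, h1, h2⟩ := (P.valuation K).exists_valuationSubring_extension
    (algebraMap K (AlgebraicClosure K))
  refine ⟨B, ?_, fun c hc => ?_⟩
  · have := h2 p (by rw [hP, ← WithZero.exp_zero, WithZero.exp_lt_exp]; norm_num)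
    rwa [map_natCast] at this
  · set m := WithZero.log (P.valuation K c)
    have hc0 : P.valuation K c ≠ 0 := (Valuation.ne_zero_iff _).mpr hc
    have hcm : P.valuation K c = WithZero.exp m := (WithZero.exp_log hc0).symm
    have h3 := h1 (c * (p : K) ^ m) (by
      rw [map_mul, map_zpow₀, hP, hcm, ← WithZero.exp_zsmul, ← WithZero.exp_add]
      simp)
    refine ⟨-m, ?_⟩
    rw [map_mul, map_zpow₀, map_natCast, map_mul, map_zpow₀] at h3
    rw [zpow_neg]
    exact eq_inv_of_mul_eq_one_left h3

/-! ### The Galois group of the cyclotomic extension. -/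

namespace EllCurve

section Cyclotomic

variable {K : Type*} [Field K] {p : ℕ} [Fact p.Prime]

/-- An element of the field generated by the roots of unity of `p`-power order lies in the field
generated by one of them. -/
theorem exists_mem_adjoin_primitiveRoot [CharZero K] {w : AlgebraicClosure K}
    (hw : w ∈ IntermediateField.adjoin K {ζ : AlgebraicClosure K | ∃ n : ℕ, ζ ^ p ^ n = 1}) :
    ∃ (n : ℕ) (ζ : AlgebraicClosure K), IsPrimitiveRoot ζ (p ^ (n + 1)) ∧
      w ∈ IntermediateField.adjoin K {ζ} := by
  have hp := (Fact.out : p.Prime)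
  obtain ⟨T, hT, hwT⟩ := IntermediateField.exists_finset_of_mem_adjoin hw
  have hT' : ∀ ξ ∈ T, ∃ n : ℕ, ξ ^ p ^ n = 1 := fun ξ hξ => hT hξ
  choose! m hm using hT'
  set n := T.sup m
  have : NeZero (p ^ (n + 1)) := ⟨pow_ne_zero _ hp.ne_zero⟩
  have : NeZero ((p ^ (n + 1) : ℕ) : AlgebraicClosure K) :=
    ⟨Nat.cast_ne_zero.mpr (NeZero.ne (p ^ (n + 1)))⟩
  obtain ⟨ζ, hζ⟩ := HasEnoughRootsOfUnity.exists_primitiveRoot (AlgebraicClosure K) (p ^ (n + 1))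
  refine ⟨n, ζ, hζ, ?_⟩
  refine IntermediateField.adjoin_le_iff.mpr (fun ξ hξ => ?_) hwT
  have h1 : ξ ^ p ^ (n + 1) = 1 := by
    have : p ^ m ξ ∣ p ^ (n + 1) :=
      pow_dvd_pow p ((Finset.le_sup (f := m) hξ).trans (Nat.le_succ _))
    obtain ⟨k, hk⟩ := this
    rw [hk, pow_mul, hm ξ hξ, one_pow]
  obtain ⟨i, -, rfl⟩ := hζ.eq_pow_of_pow_eq_one h1
  exact pow_mem (IntermediateField.mem_adjoin_simple_self K ζ) i

variable {L : IntermediateField K (AlgebraicClosure K)}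

/-- In a `ℤ_p`-extension every automorphism is a `(p - 1)`-st power. -/
theorem IsCyclotomicZpExtension.exists_pow_eq (hL : IsCyclotomicZpExtension p L) (σ : Gal(L/K)) :
    ∃ τ : Gal(L/K), τ ^ (p - 1) = σ := by
  obtain ⟨e⟩ := hL.galois_group
  have hu : IsUnit ((p - 1 : ℕ) : ℤ_[p]) := by
    rw [PadicInt.isUnit_iff, PadicInt.norm_natCast_p_sub_one]
  obtain ⟨u, hu⟩ := hu
  refine ⟨e.symm (Multiplicative.ofAdd ((u⁻¹ : ℤ_[p]ˣ) * (e σ).toAdd)), e.injective ?_⟩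
  rw [map_pow, e.apply_symm_apply, ← ofAdd_nsmul, nsmul_eq_mul, ← hu, Units.mul_inv_cancel_left]
  rfl

/-- The cyclotomic `ℤ_p`-extension of a number field in which `p` splits completely has a place
above `p` whose inertia group is the whole Galois group and acts by units congruent to one. -/
theorem IsCyclotomicZpExtension.exists_valuationSubring [NumberField K]
    (hL : IsCyclotomicZpExtension p L) (hp : SplitsCompletely p K) :
    ∃ B : ValuationSubring (AlgebraicClosure K), B.valuation (p : AlgebraicClosure K) < 1 ∧
      ∀ (σ : Gal(L/K)) (w : L), w ≠ 0 →
        B.valuation.comap (algebraMap L (AlgebraicClosure K)) (σ w - w) <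
          B.valuation.comap (algebraMap L (AlgebraicClosure K)) w := by
  obtain ⟨B, hB, hK⟩ := hp.exists_valuationSubring
  refine ⟨B, hB, fun σ w hw => ?_⟩
  have := hL.isGalois
  obtain ⟨τ, rfl⟩ := hL.exists_pow_eq σ
  obtain ⟨τ, rfl⟩ := AlgEquiv.restrictNormalHom_surjective (F := K) (K₁ := L) (AlgebraicClosure K) τ
  obtain ⟨n, ζ, hζ, hwζ⟩ := exists_mem_adjoin_primitiveRoot (hL.le_cyclotomic w.2)
  have hpp := (Fact.out : p.Prime)
  have : NeZero (p ^ (n + 1)) := ⟨pow_ne_zero _ hpp.ne_zero⟩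
  have hτζ : IsPrimitiveRoot (τ ζ) (p ^ (n + 1)) := hζ.map_of_injective τ.injective
  obtain ⟨b, -, hb⟩ := hζ.eq_pow_of_pow_eq_one hτζ.pow_eq_one
  have hcop : b.Coprime p := by
    rw [← hb, hζ.pow_iff_coprime (NeZero.pos _)] at hτζ
    exact hτζ.coprime_dvd_right (dvd_pow_self p (by omega))
  have hpow (m : ℕ) : (τ ^ m) ζ = ζ ^ b ^ m := by
    induction m with
    | zero => simp
    | succ m ih => rw [pow_succ', AlgEquiv.mul_apply, ih, map_pow, ← hb, ← pow_mul, pow_succ']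
  -- Fermat's little theorem: this is why `σ` was written as a `(p - 1)`-st power.
  have ha : b ^ (p - 1) ≡ 1 [MOD p] := by
    have := Nat.ModEq.pow_totient hcop
    rwa [Nat.totient_prime hpp] at this
  have key := B.valuation.map_apply_sub_lt_of_mem_adjoin hB hK hζ (τ ^ (p - 1)) ha (hpow _) hwζ
    (by simpa using hw)
  rw [← map_pow, Valuation.comap_apply, Valuation.comap_apply, _root_.map_sub]
  rw [show algebraMap L (AlgebraicClosure K) (AlgEquiv.restrictNormalHom L (τ ^ (p - 1)) w) =
    (τ ^ (p - 1)) w from AlgEquiv.restrictNormalHom_apply L (τ ^ (p - 1)) w]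
  exact key

/-- A topological generator of the Galois group of a `ℤ_p`-extension. -/
theorem IsCyclotomicZpExtension.exists_generator (hL : IsCyclotomicZpExtension p L) :
    ∃ γ : Gal(L/K), (∀ x : L, γ x = x → ∀ σ : Gal(L/K), σ x = x) ∧
      ∀ x : L, ∃ k₀ : ℕ, ∀ k ≥ k₀, (γ ^ p ^ k) x = x := by
  obtain ⟨e⟩ := hL.galois_group
  have := hL.isGalois
  have hcont : Continuous fun z : ℤ_[p] => e.symm (Multiplicative.ofAdd z) :=
    e.symm.continuous.comp continuous_ofAdd
  have hpow (n : ℕ) : e.symm (Multiplicative.ofAdd (n : ℤ_[p])) =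
      e.symm (Multiplicative.ofAdd 1) ^ n := by
    rw [← map_pow, ← ofAdd_nsmul, nsmul_one]
  have hmem (x : L) (σ : Gal(L/K)) :
      σ ∈ (IntermediateField.adjoin K {x}).fixingSubgroup ↔ σ x = x := by
    rw [← Subgroup.zpowers_le, ← IntermediateField.le_iff_le, IntermediateField.adjoin_simple_le_iff]
    constructor
    · intro h
      exact h ⟨σ, Subgroup.mem_zpowers σ⟩
    · intro h τ
      have hle : Subgroup.zpowers σ ≤ MulAction.stabilizer Gal(L/K) x := by
        rw [Subgroup.zpowers_le]
        exact h
      exact hle τ.2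
  have hfin (x : L) : FiniteDimensional K (IntermediateField.adjoin K {x}) :=
    IntermediateField.adjoin.finiteDimensional (Algebra.IsIntegral.isIntegral x)
  refine ⟨e.symm (Multiplicative.ofAdd 1), fun x hx σ => ?_, fun x => ?_⟩
  -- The generator corresponds to 1. Its natural powers are dense and the stabilizer of `x` is
  -- closed.
  · have hcl : IsClosed {z : ℤ_[p] | e.symm (Multiplicative.ofAdd z) ∈
        (IntermediateField.adjoin K {x}).fixingSubgroup} :=
      (IntermediateField.fixingSubgroup_isClosed _).preimage hcont
    have huniv := PadicInt.denseRange_natCast.induction_on (p := fun z => e.symm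
      (Multiplicative.ofAdd z) ∈ (IntermediateField.adjoin K {x}).fixingSubgroup) (e σ).toAdd hcl
      fun n => by
        rw [hpow]
        exact pow_mem ((hmem x _).mpr hx) n
    rw [ofAdd_toAdd, e.symm_apply_apply] at huniv
    exact (hmem x σ).mp huniv
  -- The stabilizer of `x` is also open, and `p ^ k` tends to 0.
  · have hop : IsOpen {z : ℤ_[p] | e.symm (Multiplicative.ofAdd z) ∈
        (IntermediateField.adjoin K {x}).fixingSubgroup} :=
      (IntermediateField.fixingSubgroup_isOpen _).preimage hcont
    have h0 : (0 : ℤ_[p]) ∈ {z : ℤ_[p] | e.symm (Multiplicative.ofAdd z) ∈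
        (IntermediateField.adjoin K {x}).fixingSubgroup} := by
      simp
    have hlim := tendsto_pow_atTop_nhds_zero_of_norm_lt_one (x := (p : ℤ_[p]))
      (PadicInt.norm_natCast_lt_one_iff.mpr dvd_rfl)
    obtain ⟨k₀, hk₀⟩ := Filter.eventually_atTop.mp (hlim.eventually (hop.mem_nhds h0))
    refine ⟨k₀, fun k hk => ?_⟩
    have h1 := hk₀ k hk
    rw [← Nat.cast_pow, hpow] at h1
    exact (hmem x _).mp h1

end Cyclotomic

/-- An endomorphism of `p`-power order fixes a nonzero element of order `p`. -/
theorem exists_fixed_of_iterate_prime_pow_eq {A : Type*} [AddCommGroup A] {p k : ℕ}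
    (hp : p.Prime) (γ : A →+ A) {a : A} (ha : a ≠ 0) (hpa : p • a = 0)
    (hγ : γ^[p ^ k] a = a) : ∃ b : A, b ≠ 0 ∧ p • b = 0 ∧ γ b = b := by
  classical
  set g : AddMonoid.End A := γ
  replace hγ : (g ^ p ^ k) a = a := hγ
  obtain ⟨r, hr⟩ := (Commute.one_right (g - 1)).exists_add_pow_prime_pow_eq hp k
  -- Modulo `p`, `(g - 1) ^ p ^ k` equals `g ^ p ^ k - 1`, which kills `a`. The last nonzero iterate
  -- of `g - 1` on `a` is then fixed by `g`.
  have hex : ∃ m : ℕ, ((g - 1) ^ m : AddMonoid.End A) a = 0 := by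
    refine ⟨p ^ k, ?_⟩
    rw [mul_one, mul_assoc] at hr
    have h1 := congrArg (fun f : AddMonoid.End A => f a) hr
    simp only [sub_add_cancel, one_pow] at h1
    have h2 : ((p : AddMonoid.End A) * ((g - 1) * r)) a = 0 := by
      rw [← nsmul_eq_mul, show (p • ((g - 1) * r)) a = p • ((g - 1) * r) a from rfl, ← map_nsmul, hpa, map_zero]
    have h3 : (g ^ p ^ k) a = ((g - 1) ^ p ^ k) a + a + ((p : AddMonoid.End A) * ((g - 1) * r)) a := by
      rw [h1]
      rfl
    rw [h2, hγ, add_zero] at h3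
    exact left_eq_add.mp (h3.trans (add_comm _ _))
  have hm0 : Nat.find hex ≠ 0 := by
    intro h0
    have := Nat.find_spec hex
    rw [h0, pow_zero] at this
    exact ha this
  obtain ⟨m, hm⟩ := Nat.exists_eq_succ_of_ne_zero hm0
  refine ⟨((g - 1) ^ m) a, Nat.find_min hex (by omega), ?_, ?_⟩
  · rw [← map_nsmul, hpa, map_zero]
  · have := Nat.find_spec hex
    rw [hm, Nat.succ_eq_add_one, pow_succ'] at this
    exact sub_eq_zero.mp this

end EllCurve

/-! ### The two curves and the conclusion. -/

namespace EllCurve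

open WeierstrassCurve.Affine

section Curve

variable (i : Fin 2) {F : Type*} [Field F] [Algebra ℚ F] {Γ : Type*}
  [LinearOrderedCommGroupWithZero Γ] (v : Valuation F Γ)

theorem isIntegralAt_E : IsIntegralAt v ((E i)⁄F) := by
  fin_cases i <;> constructor <;>
    simp [E, WeierstrassCurve.baseChange, WeierstrassCurve.map, v.map_ofNat_le_one]

variable {v}

/-- The invariants `b₂, b₄, b₆, b₈` are `5, -19, -39, -139` and `5, -9, 9, -9`, all odd; the
integers supplied are the halves of `b - 1`. -/
theorem val_b_sub_one_lt (hv : v (2 : F) < 1) :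
    v (((E i)⁄F).b₂ - 1) < 1 ∧ v (((E i)⁄F).b₄ - 1) < 1 ∧ v (((E i)⁄F).b₆ - 1) < 1 ∧
      v (((E i)⁄F).b₈ - 1) < 1 := by
  have h (n : ℤ) : v ((n : F) * 2) < 1 := v.map_mul_lt_of_le_one (v.map_intCast_le_one n) hv
  fin_cases i
  · refine ⟨?_, ?_, ?_, ?_⟩
    · convert h 2 using 2
      simp [E, WeierstrassCurve.b₂, WeierstrassCurve.baseChange, WeierstrassCurve.map]
      norm_num
    · convert h (-10) using 2
      simp [E, WeierstrassCurve.b₄, WeierstrassCurve.baseChange, WeierstrassCurve.map]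
      norm_num
    · convert h (-20) using 2
      simp [E, WeierstrassCurve.b₆, WeierstrassCurve.baseChange, WeierstrassCurve.map]
      norm_num
    · convert h (-70) using 2
      simp [E, WeierstrassCurve.b₈, WeierstrassCurve.baseChange, WeierstrassCurve.map]
      norm_num
  · refine ⟨?_, ?_, ?_, ?_⟩
    · convert h 2 using 2
      simp [E, WeierstrassCurve.b₂, WeierstrassCurve.baseChange, WeierstrassCurve.map]
      norm_num
    · convert h (-5) using 2
      simp [E, WeierstrassCurve.b₄, WeierstrassCurve.baseChange, WeierstrassCurve.map]
      norm_num
    · convert h 4 using 2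
      simp [E, WeierstrassCurve.b₆, WeierstrassCurve.baseChange, WeierstrassCurve.map]
    · convert h (-5) using 2
      simp [E, WeierstrassCurve.b₈, WeierstrassCurve.baseChange, WeierstrassCurve.map]
      norm_num

/-- The `x`-coordinates of the three points of order two are rational, and two of them differ by
a power of two. -/
theorem exists_twoTorsion_roots (hv : v (2 : F) = 1) : ∃ e₁ e₂ e₃ : ℚ,
    v (algebraMap ℚ F e₁) ≤ 1 ∧ v (algebraMap ℚ F e₁ - algebraMap ℚ F e₂) = 1 ∧
      ∀ x : F, 4 * x ^ 3 + ((E i)⁄F).b₂ * x ^ 2 + 2 * ((E i)⁄F).b₄ * x + ((E i)⁄F).b₆ =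
        4 * ((x - algebraMap ℚ F e₁) * (x - algebraMap ℚ F e₂) * (x - algebraMap ℚ F e₃)) := by
  have : CharZero F := charZero_of_injective_algebraMap (algebraMap ℚ F).injective
  have h4 : v (4 : F) = 1 := by
    rw [show (4 : F) = 2 * 2 by norm_num, map_mul, hv, one_mul]
  fin_cases i
  -- The order matters: the first two roots differ by 4, whereas the other differences, `9 / 4` and
  -- `25 / 4`, are not units at 3 and 5 respectively.
  · refine ⟨-1, 3, -13 / 4, by simp, ?_, fun x => ?_⟩
    · rw [← _root_.map_sub, show (-1 - 3 : ℚ) = -4 by norm_num]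
      simpa using h4
    · simp [E, WeierstrassCurve.b₂, WeierstrassCurve.b₄, WeierstrassCurve.b₆,
        WeierstrassCurve.baseChange, WeierstrassCurve.map]
      field_simp
      ring
  · refine ⟨1, -3, 3 / 4, by simp, ?_, fun x => ?_⟩
    · rw [← _root_.map_sub, show (1 - -3 : ℚ) = 4 by norm_num]
      simpa using h4
    · simp [E, WeierstrassCurve.b₂, WeierstrassCurve.b₄, WeierstrassCurve.b₆,
        WeierstrassCurve.baseChange, WeierstrassCurve.map]
      field_simp
      ring

end Curve

/-- The curves have no points of odd order over quadratic fields. -/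
theorem eq_zero_of_odd_nsmul_eq_zero (i : Fin 2) {K : Type*} [Field K] [NumberField K]
    [DecidableEq K] (hK : Module.finrank ℚ K = 2) {n : ℕ} (hn : Odd n) {P : ((E i)⁄K).Point}
    (hP : n • P = 0) : P = 0 := by
  obtain ⟨B, -, hB⟩ := (Rat.padicValuation 2).exists_valuationSubring_extension (algebraMap ℚ K)
  have h2 : B.valuation (2 : K) < 1 := by
    have h := hB (2 : ℕ) (by
      rw [Rat.padicValuation_self, ← WithZero.exp_zero, WithZero.exp_lt_exp]
      norm_num)
    simpa using h
  obtain ⟨h₂, h₄, h₆, h₈⟩ := val_b_sub_one_lt i h2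
  exact Point.eq_zero_of_odd_nsmul_eq_zero hK h2 (isIntegralAt_E i _) h₂ h₄ h₆ h₈ hn hP

variable (i : Fin 2) {K : Type*} [Field K] [NumberField K]
  {L : IntermediateField K (AlgebraicClosure K)} [DecidableEq L]

/-- A point of odd order over a Galois extension of a quadratic field vanishes if it is fixed by
the Galois group. -/
theorem eq_zero_of_fixed [IsGalois K L] (hK : Module.finrank ℚ K = 2) {n : ℕ} (hn : Odd n)
    {P : ((E i)⁄L).Point} (hP : n • P = 0)
    (hfix : ∀ σ : Gal(L/K), Point.map (W' := E i) (σ : L →ₐ[K] L) P = P) : P = 0 := by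
  classical
  rcases P with _ | ⟨x, y, h⟩
  · rfl
  have hxy (σ : Gal(L/K)) : σ x = x ∧ σ y = y := by
    have := hfix σ
    rw [Point.map_some] at this
    simpa using this
  obtain ⟨x, rfl⟩ := (InfiniteGalois.mem_range_algebraMap_iff_fixed x).mpr fun σ => (hxy σ).1
  obtain ⟨y, rfl⟩ := (InfiniteGalois.mem_range_algebraMap_iff_fixed y).mpr fun σ => (hxy σ).2
  have h' : ((E i)⁄K).Nonsingular x y :=
    (baseChange_nonsingular (E i) (f := Algebra.ofId K L) (algebraMap K L).injective x y).mp h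
  have hmap : Point.map (W' := E i) (Algebra.ofId K L) (.some x y h') = .some _ _ h := by
    rw [Point.map_some]
    rfl
  rw [← hmap, ← map_nsmul] at hP
  have h0 := eq_zero_of_odd_nsmul_eq_zero i hK hn
    (Point.map_injective (W' := E i) (Algebra.ofId K L) (hP.trans (Point.map_zero _).symm))
  exact Point.some_ne_zero h' h0 |>.elim

/-- Points of order prime to `2 * p` over the cyclotomic `ℤ_p`-extension are fixed by the Galois
group. -/
theorem map_eq_self_of_nsmul_eq_zero {p : ℕ} [Fact p.Prime] (hp2 : p ≠ 2)
    (hp : SplitsCompletely p K) (hL : IsCyclotomicZpExtension p L) {n : ℕ} (hn : Odd n)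
    (hnp : p.Coprime n) {P : ((E i)⁄L).Point} (hP : n • P = 0) (σ : Gal(L/K)) :
    Point.map (W' := E i) (σ : L →ₐ[K] L) P = P := by
  rcases P with _ | ⟨x, y, h⟩
  · rfl
  obtain ⟨B, hB, hσ⟩ := hL.exists_valuationSubring hp
  set v := B.valuation.comap (algebraMap L (AlgebraicClosure K)) with hv
  have hpv : v ((p : ℤ) : L) < 1 := by
    rw [hv, Valuation.comap_apply, map_intCast]
    exact_mod_cast hB
  have hvn : v (n : L) = 1 := by
    simpa using v.map_intCast_eq_one_of_isCoprime hpv (Nat.isCoprime_iff_coprime.mpr hnp)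
  have hv2 : v (2 : L) = 1 := by
    have := v.map_intCast_eq_one_of_isCoprime (n := (2 : ℕ)) hpv
      (Nat.isCoprime_iff_coprime.mpr ((Nat.coprime_primes Fact.out Nat.prime_two).mpr hp2))
    simpa using this
  have hW := isIntegralAt_E (F := L) i v
  obtain ⟨e₁, e₂, e₃, he₁, he, hfac⟩ := exists_twoTorsion_roots (F := L) i hv2
  -- A nonzero point of odd order is not 2-torsion, so `Y` and every `x - e` are nonzero, as the
  -- strict estimate on `σ w - w` requires.
  have hY0 : y - ((E i)⁄L).negY x y ≠ 0 := by
    intro h0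
    have h2 : 2 • (Point.some x y h : ((E i)⁄L).Point) = 0 := by
      rw [two_nsmul, Point.add_self_of_Y_eq (sub_eq_zero.mp h0)]
    obtain ⟨k, rfl⟩ := hn
    rw [add_smul, mul_comm, mul_smul, h2, smul_zero, one_smul, zero_add] at hP
    exact Point.some_ne_zero h hP
  have hprod : (y - ((E i)⁄L).negY x y) ^ 2 = 4 * ((x - algebraMap ℚ L e₁) *
      (x - algebraMap ℚ L e₂) * (x - algebraMap ℚ L e₃)) := by
    rw [← hfac, negY, WeierstrassCurve.b₂, WeierstrassCurve.b₄, WeierstrassCurve.b₆]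
    linear_combination 4 * (equation_iff _ _).mp h.1
  have hprod0 := hprod ▸ pow_ne_zero 2 hY0
  have hclose (e : ℚ) (he : x - algebraMap ℚ L e ≠ 0) : v (σ x - x) < v (x - algebraMap ℚ L e) := by
    have := hσ σ _ he
    rwa [_root_.map_sub σ, show σ (algebraMap ℚ L e) = algebraMap ℚ L e by simp,
      sub_sub_sub_cancel_right] at this
  have hker := Point.inKernel_sub hW hv2 he₁ he hfac h
    ((baseChange_nonsingular (E i) (f := (σ : L →ₐ[K] L)) σ.injective x y).mpr h)
    (hclose e₁ fun h0 => hprod0 (by rw [h0]; ring)) (hclose e₂ fun h0 => hprod0 (by rw [h0]; ring))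
    (hclose e₃ fun h0 => hprod0 (by rw [h0]; ring)) (by
      have := hσ σ _ hY0
      rw [_root_.map_sub σ] at this
      rwa [← show ((E i)⁄L).negY (σ x) (σ y) = σ (((E i)⁄L).negY x y) from
        baseChange_negY (W' := E i) (σ : L →ₐ[K] L) x y] at this)
  have hsub := Point.eq_zero_of_inKernel_of_nsmul_eq_zero hW hker hvn (by
    rw [smul_sub, hP, sub_zero]
    have := congrArg (Point.map (W' := E i) (σ : L →ₐ[K] L)) hP
    rwa [map_nsmul, Point.map_some, Point.map_zero] at this)
  rw [Point.map_some]
  exact sub_eq_zero.mp hsub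

/-- The curves have no points of odd prime order over the cyclotomic `ℤ_p`-extension. -/
theorem eq_zero_of_prime_nsmul_eq_zero {p : ℕ} [Fact p.Prime] (hp2 : p ≠ 2)
    (hK : Module.finrank ℚ K = 2) (hp : SplitsCompletely p K) (hL : IsCyclotomicZpExtension p L)
    {l : ℕ} (hl : l.Prime) (hl2 : l ≠ 2) {P : ((E i)⁄L).Point} (hP : l • P = 0) : P = 0 := by
  have := hL.isGalois
  have hodd := hl.odd_of_ne_two hl2
  by_cases hlp : l = p
  · subst hlp
    by_contra hP0
    obtain ⟨γ, hγ, hγk⟩ := hL.exists_generator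
    have hpow (m : ℕ) (Q : ((E i)⁄L).Point) : (Point.map (W' := E i) (γ : L →ₐ[K] L))^[m] Q =
        Point.map (W' := E i) ((γ ^ m : Gal(L/K)) : L →ₐ[K] L) Q := by
      induction m with
      | zero => rcases Q with _ | ⟨x, y, h⟩ <;> rfl
      | succ m ih =>
        rw [Function.iterate_succ_apply', ih, pow_succ']
        rcases Q with _ | ⟨x, y, h⟩ <;> rfl
    -- Both coordinates are fixed by `γ ^ l ^ k` for all large `k`, so the unipotence argument
    -- applies.
    obtain ⟨k, hk⟩ : ∃ k, Point.map (W' := E i) ((γ ^ l ^ k : Gal(L/K)) : L →ₐ[K] L) P = P := by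
      rcases P with _ | ⟨x, y, h⟩
      · exact ⟨0, rfl⟩
      obtain ⟨k₁, h₁⟩ := hγk x
      obtain ⟨k₂, h₂⟩ := hγk y
      refine ⟨max k₁ k₂, ?_⟩
      rw [Point.map_some]
      congr 1
      · exact h₁ _ (le_max_left _ _)
      · exact h₂ _ (le_max_right _ _)
    obtain ⟨Q, hQ0, hQl, hQ⟩ := exists_fixed_of_iterate_prime_pow_eq hl
      (Point.map (W' := E i) (γ : L →ₐ[K] L)) hP0 hP ((hpow _ P).trans hk)
    refine hQ0 (eq_zero_of_fixed i hK hodd hQl fun σ => ?_)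
    rcases Q with _ | ⟨x, y, h⟩
    · rfl
    rw [Point.map_some] at hQ ⊢
    have hxy : γ x = x ∧ γ y = y := by simpa using hQ
    congr 1
    · exact hγ x hxy.1 σ
    · exact hγ y hxy.2 σ
  · exact eq_zero_of_fixed i hK hodd hP fun σ => map_eq_self_of_nsmul_eq_zero i hp2 hp hL hodd
      ((Nat.coprime_primes Fact.out hl).mpr (Ne.symm hlp)) hP σ

/-- The curves have no points of odd prime power order over the cyclotomic `ℤ_p`-extension. -/
theorem primaryComponent_eq_bot {p : ℕ} [Fact p.Prime] (hp2 : p ≠ 2)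
    (hK : Module.finrank ℚ K = 2) (hp : SplitsCompletely p K) (hL : IsCyclotomicZpExtension p L)
    {l : ℕ} (hl : l.Prime) (hl2 : l ≠ 2) :
    AddCommGroup.primaryComponent ((E i)⁄L).Point l = ⊥ := by
  rw [eq_bot_iff]
  intro P hP
  obtain ⟨k, hk⟩ := AddCommGroup.mem_primaryComponent.mp hP
  rw [AddSubgroup.mem_bot]
  induction k with
  | zero => simpa using hk
  | succ k ih =>
    rw [pow_succ', mul_smul] at hk
    exact ih (eq_zero_of_prime_nsmul_eq_zero i hp2 hK hp hL hl hl2 hk)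

end EllCurve

theorem lemma3p5 {K : Type*} [Field K] [NumberField K] (p : ℕ) [Fact p.Prime] (i : Fin 2)
    (hKp : EllCurve.Assumptions K p i)
    (Kinf : IntermediateField K (AlgebraicClosure K)) [DecidableEq Kinf]
    (hKinf : EllCurve.IsCyclotomicZpExtension p Kinf)
    (l : ℕ) (hl : l.Prime) (hl2 : l ≠ 2) :
    (AddCommGroup.primaryComponent ((EllCurve.E i)⁄ℚ).Point l).map
        (WeierstrassCurve.Affine.Point.baseChange (W' := EllCurve.E i) ℚ Kinf) =
      AddCommGroup.primaryComponent ((EllCurve.E i)⁄Kinf).Point l := by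
  have hbot := EllCurve.primaryComponent_eq_bot i hKp.odd hKp.quadratic hKp.splits hKinf hl hl2
  -- The surjectivity is the inclusion settled by the vanishing of the right side; the other holds
  -- for any homomorphism.
  refine le_antisymm ?_ (hbot.trans_le bot_le)
  rintro _ ⟨P, hP, rfl⟩
  obtain ⟨k, hk⟩ := AddCommGroup.mem_primaryComponent.mp hP
  refine AddCommGroup.mem_primaryComponent.mpr ⟨k, ?_⟩
  rw [← map_nsmul, hk, map_zero]
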